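/- Let $N\ge 2$, let $\mathbb{H}^N$ be the $N$-dimensional hyperbolic space with Riemannian volume $dv$, fix a pole $x_0\in\mathbb{H}^N$, and let $r=d(x,x_0)$ be the geodesic distance to $x_0$. In geodesic polar coordinates $x=(r,\Theta)\in(0,\infty)\times\mathbb{S}^{N-1}$ about $x_0$ write $$u_r=\frac{\partial u}{\partial r},\qquad \nabla_r u=\Big(\frac{\partial u}{\partial r},0\Big),\qquad \Delta_r u=\frac{1}{(\sinh r)^{N-1}}\frac{\partial}{\partial r}\Big[(\sinh r)^{N-1}\frac{\partial u}{\partial r}\Big],$$ so that $|\nabla_r u|^2=u_r^2$. For $0\le\lambda\le\left(\frac{N-1}{2}\right)^2$ put $$\gamma_N(\lambda)=\sqrt{(N-1)^2-4\lambda},\qquad h_N(\lambda)=\frac{\gamma_N(\lambda)+1}{2},\qquad \Psi_\lambda(r)=r^{-\frac{N-2}{2}}\Big(\frac{\sinh r}{r}\Big)^{-\frac{N-1+\gamma_N(\lambda)}{2}}\quad(r>0).$$ **Theorem.** For all $0\le\lambda\le\left(\frac{N-1}{2}\right)^2$ and all (not necessarily radial) $u\in C_c^\infty(\mathbb{H}^N\setminus\{x_0\})$,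 $$\begin{aligned}\int_{\mathbb{H}^N}|\Delta_r u|^2\,dv={}&\lambda\int_{\mathbb{H}^N}|\nabla_r u|^2\,dv+h_N^2(\lambda)\int_{\mathbb{H}^N}\frac{|\nabla_r u|^2}{r^2}\,dv+\Big[\Big(\frac N2\Big)^2-h_N^2(\lambda)\Big]\int_{\mathbb{H}^N}\frac{|\nabla_r u|^2}{\sinh^2 r}\,dv\\&+\gamma_N(\lambda)h_N(\lambda)\int_{\mathbb{H}^N}\frac{r\coth r-1}{r^2}|\nabla_r u|^2\,dv+\int_{\mathbb{H}^N}\Psi_\lambda(r)^2\Big|\nabla_r\Big(\frac{u_r}{\Psi_\lambda(r)}\Big)\Big|^2dv.\end{aligned}$$ Furthermore, if $N\ge5$, then for every such $\lambda$ the constants $h_N^2(\lambda)$ and $\left(\frac N2\right)^2-h_N^2(\lambda)$ are jointly sharp in the following sense: for every $C>\left(\frac N2\right)^2-h_N^2(\lambda)$ the inequality $$\int_{\mathbb{H}^N}|\Delta_r u|^2\,dv\ge\lambda\int_{\mathbb{H}^N}|\nabla_r u|^2\,dv+h_N^2(\lambda)\int_{\mathbb{H}^N}\frac{|\nabla_r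 u|^2}{r^2}\,dv+C\int_{\mathbb{H}^N}\frac{|\nabla_r u|^2}{\sinh^2 r}\,dv+\gamma_N(\lambda)h_N(\lambda)\int_{\mathbb{H}^N}\frac{r\coth r-1}{r^2}|\nabla_r u|^2\,dv$$ does not hold for all $u\in C_c^\infty(\mathbb{H}^N\setminus\{x_0\})$. -/

import Mathlib

open MeasureTheory
open scoped ContDiff

noncomputable section

namespace Hyperbolic

/-- The `N`-dimensional hyperbolic space `ℍ^N`, in the hyperboloid model: the upper sheet
`{(t, x) ∈ ℝ × ℝ^N : t = √(1 + |x|²)}` of the unit hyperboloid in Minkowski space, described by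
its global smooth chart `(t, x) ↦ x`. The Riemannian structure (`metric`), the geodesic distance
(`gdist`) and the Riemannian volume (`vol`) are those of the hyperboloid; the Euclidean metric of
the chart plays no role. -/
abbrev Space (N : ℕ) : Type := EuclideanSpace ℝ (Fin N)

variable {N : ℕ}

/-- The inverse of the chart: the point `(√(1 + |x|²), x)` of the hyperboloid. -/
def lift (x : Space N) : ℝ × Space N := (√(1 + ‖x‖ ^ 2), x)

/-- The Minkowski form `⟨(s, x), (t, y)⟩ = x · y - s t` on `ℝ × ℝ^N`. -/
def minkowski (p q : ℝ × Space N) : ℝ := inner ℝ p.2 q.2 - p.1 * q.1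

/-- The hyperbolic metric: the restriction of the Minkowski form to the tangent spaces of the
hyperboloid, read in the chart. -/
def metric (x v w : Space N) : ℝ :=
  minkowski (fderiv ℝ lift x v) (fderiv ℝ lift x w)

/-- The geodesic distance of `ℍ^N`: `cosh d(x, y) = -⟨x, y⟩` on the hyperboloid. -/
def gdist (x y : Space N) : ℝ := Real.arcosh (-minkowski (lift x) (lift y))

/-- The Riemannian volume `√(det g) dx` of `ℍ^N`. -/
def vol (N : ℕ) : Measure (Space N) :=
  volume.withDensity fun x => ENNReal.ofReal (√(Matrix.det (Matrix.of fun i j : Fin N =>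
    metric x (EuclideanSpace.single i 1) (EuclideanSpace.single j 1))))

/-- Geodesic polar coordinates about the pole `x₀`: the point `exp_{x₀}(r θ)`, where `θ` is a unit
tangent vector at `x₀`. On the hyperboloid the geodesic is `cosh r · x₀ + sinh r · θ`. -/
def polar (x₀ : Space N) (r : ℝ) (θ : Space N) : Space N :=
  Real.cosh r • x₀ + Real.sinh r • θ

/-- The angular coordinate `Θ` of a point `x ≠ x₀`: the unit tangent vector at `x₀` with
`x = polar x₀ (gdist x x₀) Θ`. -/
def angle (x₀ x : Space N) : Space N :=
  (Real.sinh (gdist x x₀))⁻¹ • (x - Real.cosh (gdist x x₀) • x₀)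

/-- The radial derivative `u_r = ∂u/∂r (r, Θ)` in polar coordinates about `x₀`. -/
def radialDeriv (x₀ : Space N) (u : Space N → ℝ) (x : Space N) : ℝ :=
  deriv (fun s : ℝ => u (polar x₀ s (angle x₀ x))) (gdist x x₀)

/-- The coordinate vector field `∂/∂r` of polar coordinates about `x₀`. -/
def radialField (x₀ x : Space N) : Space N :=
  deriv (fun s : ℝ => polar x₀ s (angle x₀ x)) (gdist x x₀)

/-- The radial gradient `∇_r u = (∂u/∂r, 0)`, that is `(∂u/∂r) ∂/∂r`. -/
def radialGrad (x₀ : Space N) (u : Space N → ℝ) (x : Space N) : Space N :=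
  radialDeriv x₀ u x • radialField x₀ x

/-- The square `|v|²` of the Riemannian norm of a tangent vector `v` at `x`. -/
def normSq (x v : Space N) : ℝ := metric x v v

/-- The radial Laplacian `Δ_r u = (sinh r)^{-(N-1)} ∂/∂r ((sinh r)^{N-1} ∂u/∂r)`. -/
def radialLaplacian (x₀ : Space N) (u : Space N → ℝ) (x : Space N) : ℝ :=
  1 / Real.sinh (gdist x x₀) ^ (N - 1) *
    radialDeriv x₀ (fun y => Real.sinh (gdist y x₀) ^ (N - 1) * radialDeriv x₀ u y) x

/-- `C_c^∞(ℍ^N ∖ {x₀})`: smooth functions with compact support not containing the pole. -/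
def IsTestFunction (x₀ : Space N) (u : Space N → ℝ) : Prop :=
  ContDiff ℝ ∞ u ∧ HasCompactSupport u ∧ x₀ ∉ tsupport u

/-- `γ_N(λ) = √((N-1)² - 4λ)`. -/
def gam (N : ℕ) (lam : ℝ) : ℝ := √(((N : ℝ) - 1) ^ 2 - 4 * lam)

/-- `h_N(λ) = (γ_N(λ) + 1) / 2`. -/
def hN (N : ℕ) (lam : ℝ) : ℝ := (gam N lam + 1) / 2

/-- `Ψ_λ(r) = r^{-(N-2)/2} (sinh r / r)^{-(N-1+γ_N(λ))/2}`, for `r > 0`. -/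
def Psi (N : ℕ) (lam r : ℝ) : ℝ :=
  r ^ (-(((N : ℝ) - 2) / 2)) * (Real.sinh r / r) ^ (-(((N : ℝ) - 1 + gam N lam) / 2))

/-- The hyperbolic cotangent. -/
def coth (r : ℝ) : ℝ := Real.cosh r / Real.sinh r

theorem fderiv_lift (x v : Space N) :
    fderiv ℝ lift x v = (inner ℝ x v / √(1 + ‖x‖ ^ 2), v) := by
  have hpos : (0 : ℝ) < 1 + ‖x‖ ^ 2 := by positivity
  have h1 : HasFDerivAt (fun y : Space N => 1 + ‖y‖ ^ 2) (2 • innerSL ℝ x) x :=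
    (hasStrictFDerivAt_norm_sq x).hasFDerivAt.const_add 1
  have h2 := (h1.sqrt hpos.ne').prodMk (hasFDerivAt_id x)
  have h3 : HasFDerivAt (lift (N := N)) _ x := h2
  rw [h3.fderiv]
  ext
  · simp
    field_simp
  · simp

/-- The metric in the chart. -/
theorem metric_eq (x v w : Space N) :
    metric x v w = inner ℝ v w - inner ℝ x v * inner ℝ x w / (1 + ‖x‖ ^ 2) := by
  have hpos : (0 : ℝ) < 1 + ‖x‖ ^ 2 := by positivity
  simp only [metric, minkowski, fderiv_lift]
  rw [div_mul_div_comm, Real.mul_self_sqrt hpos.le]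

theorem vol_eq (N : ℕ) :
    vol N = volume.withDensity fun x : Space N => ENNReal.ofReal (1 / √(1 + ‖x‖ ^ 2)) := by
  unfold vol
  congr 1
  funext x
  have hpos : (0 : ℝ) < 1 + ‖x‖ ^ 2 := by positivity
  have hm : (Matrix.of fun i j : Fin N =>
      metric x (EuclideanSpace.single i 1) (EuclideanSpace.single j 1)) =
      1 + Matrix.replicateCol Unit (fun i => -(x i) / (1 + ‖x‖ ^ 2)) *
        Matrix.replicateRow Unit (fun i => x i) := by
    ext i j
    simp only [Matrix.of_apply, metric_eq, Matrix.add_apply, Matrix.mul_apply]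
    simp [Matrix.one_apply, EuclideanSpace.inner_single_right, eq_comm]
    ring
  rw [hm, Matrix.det_one_add_replicateCol_mul_replicateRow, ← Real.sqrt_one,
    ← Real.sqrt_div zero_le_one, Real.sqrt_one]
  congr 2
  have : (fun i => x i) ⬝ᵥ (fun i => -(x i) / (1 + ‖x‖ ^ 2)) = -‖x‖ ^ 2 / (1 + ‖x‖ ^ 2) := by
    rw [EuclideanSpace.real_norm_sq_eq, dotProduct, ← Finset.sum_neg_distrib, Finset.sum_div]
    exact Finset.sum_congr rfl fun i _ => by ring
  rw [this]
  field_simp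
  ring

theorem gdist_pos {x₀ x : Space N} (h : x ≠ x₀) : 0 < gdist x x₀ := by
  have hx : (0 : ℝ) < 1 + ‖x‖ ^ 2 := by positivity
  have hy : (0 : ℝ) < 1 + ‖x₀‖ ^ 2 := by positivity
  have hd : 0 < ‖x - x₀‖ ^ 2 := by
    have := sub_ne_zero.2 h
    positivity
  have hc := real_inner_mul_inner_self_le x x₀
  rw [real_inner_self_eq_norm_sq, real_inner_self_eq_norm_sq] at hc
  rw [norm_sub_sq_real] at hd
  have : 1 + inner ℝ x x₀ < √((1 + ‖x‖ ^ 2) * (1 + ‖x₀‖ ^ 2)) := by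
    apply Real.lt_sqrt_of_sq_lt
    nlinarith
  rw [Real.sqrt_mul hx.le] at this
  refine Real.arcosh_pos ?_
  simp only [minkowski, lift, neg_sub]
  linarith

theorem cosh_gdist (x₀ x : Space N) :
    Real.cosh (gdist x x₀) = √(1 + ‖x‖ ^ 2) * √(1 + ‖x₀‖ ^ 2) - inner ℝ x x₀ := by
  have hx : (0 : ℝ) < 1 + ‖x‖ ^ 2 := by positivity
  have hc := real_inner_mul_inner_self_le x x₀
  rw [real_inner_self_eq_norm_sq, real_inner_self_eq_norm_sq] at hc
  have hd : 0 ≤ ‖x - x₀‖ ^ 2 := by positivity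
  rw [norm_sub_sq_real] at hd
  have : 1 + inner ℝ x x₀ ≤ √((1 + ‖x‖ ^ 2) * (1 + ‖x₀‖ ^ 2)) := by
    apply Real.le_sqrt_of_sq_le
    nlinarith
  rw [Real.sqrt_mul hx.le] at this
  rw [gdist, Real.cosh_arcosh] <;> simp only [minkowski, lift, neg_sub]
  linarith

/-- Polar coordinates recover the point. -/
theorem polar_angle {x₀ x : Space N} (h : x ≠ x₀) :
    polar x₀ (gdist x x₀) (angle x₀ x) = x := by
  have hs : Real.sinh (gdist x x₀) ≠ 0 := (Real.sinh_pos_iff.2 (gdist_pos h)).ne'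
  rw [polar, angle, smul_inv_smul₀ hs]
  abel

/-- The angular coordinate is a unit tangent vector at the pole. -/
theorem normSq_angle {x₀ x : Space N} (h : x ≠ x₀) : normSq x₀ (angle x₀ x) = 1 := by
  have hs : Real.sinh (gdist x x₀) ≠ 0 := (Real.sinh_pos_iff.2 (gdist_pos h)).ne'
  have hsq := Real.cosh_sq (gdist x x₀)
  have hx : (0 : ℝ) < 1 + ‖x‖ ^ 2 := by positivity
  have hy : (0 : ℝ) < 1 + ‖x₀‖ ^ 2 := by positivity
  have e1 := Real.sq_sqrt hx.le
  have e2 := Real.sq_sqrt hy.le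
  have hc := cosh_gdist x₀ x
  rw [normSq, metric_eq, angle]
  generalize Real.sinh (gdist x x₀) = S at *
  generalize Real.cosh (gdist x x₀) = K at *
  simp only [inner_smul_left, inner_smul_right, inner_sub_left, inner_sub_right,
    real_inner_self_eq_norm_sq, real_inner_comm x x₀, map_inv₀, conj_trivial]
  generalize (inner ℝ x x₀ : ℝ) = I at *
  generalize √(1 + ‖x‖ ^ 2) = A at *
  generalize √(1 + ‖x₀‖ ^ 2) = B at *
  have hxA : ‖x‖ ^ 2 = A ^ 2 - 1 := by linarith
  have hyB : ‖x₀‖ ^ 2 = B ^ 2 - 1 := by linarith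
  rw [hxA, hyB, add_sub_cancel]
  have hB : B ≠ 0 := by rintro rfl; norm_num at e2; linarith
  have hI : I = A * B - K := by linarith
  have hS : S ^ 2 = K ^ 2 - 1 := by linarith
  field_simp
  rw [hS, hI]
  ring

/-- `polar x₀ · θ` is the geodesic `cosh s · x₀ + sinh s · θ` of the hyperboloid. -/
theorem lift_polar {x₀ θ : Space N} (hθ : normSq x₀ θ = 1) (s : ℝ) :
    lift (polar x₀ s θ) = Real.cosh s • lift x₀ + Real.sinh s • fderiv ℝ lift x₀ θ := by
  have hy : (0 : ℝ) < 1 + ‖x₀‖ ^ 2 := by positivity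
  have e2 := Real.sq_sqrt hy.le
  have hB : 0 < √(1 + ‖x₀‖ ^ 2) := Real.sqrt_pos.2 hy
  have hc := real_inner_mul_inner_self_le x₀ θ
  rw [real_inner_self_eq_norm_sq, real_inner_self_eq_norm_sq] at hc
  rw [normSq, metric_eq, real_inner_self_eq_norm_sq, ← e2] at hθ
  have hK := Real.cosh_sq s
  have hK0 := Real.cosh_pos s
  rw [fderiv_lift]
  refine Prod.ext ?_ rfl
  simp only [lift, polar, Prod.fst_add, Prod.smul_fst, smul_eq_mul]
  rw [norm_add_sq_real, norm_smul, norm_smul, mul_pow, mul_pow, inner_smul_left, inner_smul_right]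
  simp only [Real.norm_eq_abs, sq_abs, conj_trivial]
  generalize Real.sinh s = S at *
  generalize Real.cosh s = K at *
  generalize (inner ℝ x₀ θ : ℝ) = I at *
  generalize √(1 + ‖x₀‖ ^ 2) = B at *
  have hyB : ‖x₀‖ ^ 2 = B ^ 2 - 1 := by linarith
  obtain ⟨J, rfl⟩ : ∃ J, I = B * J := ⟨I / B, by field_simp⟩
  have hT : ‖θ‖ ^ 2 = 1 + J ^ 2 := by
    field_simp at hθ
    linarith
  rw [mul_div_cancel_left₀ _ hB.ne']
  rw [hyB, hT]
  have hJ : J ^ 2 ≤ B ^ 2 := by rw [hyB, hT] at hc; nlinarith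
  have hSK : S ^ 2 ≤ K ^ 2 := by linarith
  have hle : (S * J) ^ 2 ≤ (K * B) ^ 2 := by
    rw [mul_pow, mul_pow]
    exact mul_le_mul hSK hJ (sq_nonneg _) (sq_nonneg _)
  have h0 := (abs_le_of_sq_le_sq' hle (by positivity)).1
  rw [show 1 + (K ^ 2 * (B ^ 2 - 1) + 2 * (K * (S * (B * J))) + S ^ 2 * (1 + J ^ 2))
    = (K * B + S * J) ^ 2 by linear_combination (-1 : ℝ) * hK]
  exact Real.sqrt_sq (by linarith)

theorem minkowski_add_smul (a b c d : ℝ) (p q r s : ℝ × Space N) :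
    minkowski (a • p + b • q) (c • r + d • s) = a * c * minkowski p r + a * d * minkowski p s
      + b * c * minkowski q r + b * d * minkowski q s := by
  simp only [minkowski, Prod.fst_add, Prod.snd_add, Prod.smul_fst, Prod.smul_snd,
    inner_add_left, inner_add_right, inner_smul_left, inner_smul_right, smul_eq_mul, conj_trivial]
  ring

theorem minkowski_lift (x : Space N) : minkowski (lift x) (lift x) = -1 := by
  have hy : (0 : ℝ) < 1 + ‖x‖ ^ 2 := by positivity
  simp only [minkowski, lift, real_inner_self_eq_norm_sq, Real.mul_self_sqrt hy.le]
  ring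

theorem minkowski_lift_fderiv (x v : Space N) :
    minkowski (lift x) (fderiv ℝ lift x v) = 0 := by
  have hy : (0 : ℝ) < 1 + ‖x‖ ^ 2 := by positivity
  have := Real.sqrt_pos.2 hy
  simp only [minkowski, fderiv_lift, lift]
  field_simp
  ring

theorem minkowski_comm (p q : ℝ × Space N) : minkowski p q = minkowski q p := by
  simp only [minkowski, real_inner_comm, mul_comm]

/-- The radial coordinate of `polar x₀ s θ` is `s`. -/
theorem gdist_polar {x₀ θ : Space N} (hθ : normSq x₀ θ = 1) {s : ℝ} (hs : 0 ≤ s) :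
    gdist (polar x₀ s θ) x₀ = s := by
  have h := minkowski_add_smul (Real.cosh s) (Real.sinh s) 1 0 (lift x₀) (fderiv ℝ lift x₀ θ)
    (lift x₀) 0
  rw [minkowski_comm (fderiv ℝ lift x₀ θ), minkowski_lift_fderiv, minkowski_lift] at h
  simp only [one_smul, smul_zero, add_zero] at h
  rw [gdist, lift_polar hθ, h]
  simpa using Real.arcosh_cosh hs

/-- The radial field is a unit vector field. -/
theorem normSq_radialField {x₀ x : Space N} (h : x ≠ x₀) : normSq x (radialField x₀ x) = 1 := by
  have hθ := normSq_angle h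
  have hp : HasDerivAt (fun s : ℝ => polar x₀ s (angle x₀ x))
      (Real.sinh (gdist x x₀) • x₀ + Real.cosh (gdist x x₀) • angle x₀ x) (gdist x x₀) :=
    ((Real.hasDerivAt_cosh _).smul_const x₀).add ((Real.hasDerivAt_sinh _).smul_const _)
  have hl : DifferentiableAt ℝ (lift (N := N)) (polar x₀ (gdist x x₀) (angle x₀ x)) := by
    have hpos (y : Space N) : (1 + ‖y‖ ^ 2 : ℝ) ≠ 0 := by positivity
    exact (((differentiableAt_id.norm_sq ℝ).const_add 1).sqrt (hpos _)).prodMk differentiableAt_id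
  have h1 := hl.hasFDerivAt.comp_hasDerivAt (gdist x x₀) hp
  have h2 : HasDerivAt (fun s : ℝ => Real.cosh s • lift x₀ +
      Real.sinh s • fderiv ℝ lift x₀ (angle x₀ x)) (Real.sinh (gdist x x₀) • lift x₀ +
      Real.cosh (gdist x x₀) • fderiv ℝ lift x₀ (angle x₀ x)) (gdist x x₀) :=
    ((Real.hasDerivAt_cosh _).smul_const _).add ((Real.hasDerivAt_sinh _).smul_const _)
  have h3 : (lift ∘ fun s : ℝ => polar x₀ s (angle x₀ x)) = fun s : ℝ => Real.cosh s • lift x₀ +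
      Real.sinh s • fderiv ℝ lift x₀ (angle x₀ x) := funext fun s => lift_polar hθ s
  rw [h3] at h1
  have h4 := h1.unique h2
  rw [polar_angle h] at h4
  rw [normSq, metric, radialField, hp.deriv, h4, minkowski_add_smul, minkowski_lift,
    minkowski_comm (fderiv ℝ lift x₀ _) (lift x₀), minkowski_lift_fderiv]
  have h5 : minkowski (fderiv ℝ lift x₀ (angle x₀ x)) (fderiv ℝ lift x₀ (angle x₀ x)) = 1 := hθ
  rw [h5]
  have := Real.cosh_sq (gdist x x₀)
  linarith

end Hyperbolic

end

/-! Put v = u_r, α = (N - 1) coth r and w = Ψ'/Ψ (`logDerivPsi`). Off the pole Δ_r u = v_r + αv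
(`radialLaplacian_eq`) and Ψ (v/Ψ)_r = v_r - wv (`radialDeriv_div_Psi`). With β = α + w, the
difference of the two squares is β (v²)_r + (α² - w²) v². The field β v² ∂/∂r has divergence β
(v²)_r + (β' + αβ) v², whose integral vanishes (`integral_radial_divergence`). What remains is the
potential α² - w² - β' - αβ multiplied by v², and `riccati_logDerivPsi` evaluates it as exactly the
four weights of the identity. Only radial derivatives occur, so u need not be radial and no
spherical decomposition is required.

For sharpness, let δ be the excess of C over its claimed value. By the identity it suffices to find
u whose remainder integral is less than δ ∫ |u_r|² / sinh² r. For radial u with u_r = Ψ f, this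
compares f'² with δ f² / sinh² r against the weight Ψ² sinh^{N-1} r. That weight behaves like r near
the pole (`Psi_sq_mul_sinh_pow`), which is the critical two-dimensional case: in the variable log r
the two integrals become those of f'² and f² up to constants, so stretching a bump in log r makes
their quotient arbitrarily small (`exists_bump_defect_pos`). For u to have compact support off the
pole, ∫ Ψ f = 0 is also needed; combining two bumps with disjoint supports achieves this
(`exists_bump_integral_zero_defect_pos`).

Integration in polar coordinates is never set up. The divergence theorem is proved by Euclidean
integration by parts in the chart, and it also yields the one fact needed about integrals of radial
functions, `integral_radial_pos`. -/

noncomputable section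

open MeasureTheory Filter Topology
open scoped ContDiff

namespace Hyperbolic

variable {N : ℕ}

/-! ### Radial derivatives in the chart. -/

/-- The radial unit field `∂/∂r` in the chart. -/
def geodesicField (x₀ x : Space N) : Space N :=
  (Real.cosh (gdist x x₀) / Real.sinh (gdist x x₀)) • x - (Real.sinh (gdist x x₀))⁻¹ • x₀

theorem sinh_gdist_pos {x₀ x : Space N} (h : x ≠ x₀) : 0 < Real.sinh (gdist x x₀) :=
  Real.sinh_pos_iff.2 (gdist_pos h)

/-- The velocity is sinh r · x₀ + cosh r · Θ. Substituting Θ = (x - cosh r · x₀) / sinh r leaves the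
coefficient sinh r - cosh² r / sinh r = -1 / sinh r on x₀. -/
theorem hasDerivAt_polar_angle {x₀ x : Space N} (h : x ≠ x₀) :
    HasDerivAt (fun s : ℝ => polar x₀ s (angle x₀ x)) (geodesicField x₀ x) (gdist x x₀) := by
  have hS := (sinh_gdist_pos h).ne'
  have hp : HasDerivAt (fun s : ℝ => polar x₀ s (angle x₀ x))
      (Real.sinh (gdist x x₀) • x₀ + Real.cosh (gdist x x₀) • angle x₀ x) (gdist x x₀) :=
    ((Real.hasDerivAt_cosh _).smul_const x₀).add ((Real.hasDerivAt_sinh _).smul_const _)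
  convert hp using 1
  rw [geodesicField, angle]
  have hc := Real.cosh_sq (gdist x x₀)
  generalize Real.sinh (gdist x x₀) = S at *
  generalize Real.cosh (gdist x x₀) = K at *
  match_scalars
  · field_simp
  · field_simp
    linarith

theorem hasDerivAt_comp_polar {x₀ x : Space N} (h : x ≠ x₀) {u : Space N → ℝ}
    (hu : DifferentiableAt ℝ u x) :
    HasDerivAt (fun s : ℝ => u (polar x₀ s (angle x₀ x)))
      (fderiv ℝ u x (geodesicField x₀ x)) (gdist x x₀) := by
  have hu' : HasFDerivAt u (fderiv ℝ u x) (polar x₀ (gdist x x₀) (angle x₀ x)) := by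
    rw [polar_angle h]
    exact hu.hasFDerivAt
  exact hu'.comp_hasDerivAt (gdist x x₀) (hasDerivAt_polar_angle h)

theorem radialDeriv_eq_fderiv {x₀ x : Space N} (h : x ≠ x₀) {u : Space N → ℝ}
    (hu : DifferentiableAt ℝ u x) :
    radialDeriv x₀ u x = fderiv ℝ u x (geodesicField x₀ x) :=
  (hasDerivAt_comp_polar h hu).deriv

theorem gdist_polar_angle_eventuallyEq {x₀ x : Space N} (h : x ≠ x₀) :
    (fun s : ℝ => gdist (polar x₀ s (angle x₀ x)) x₀) =ᶠ[𝓝 (gdist x x₀)] fun s => s := by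
  filter_upwards [lt_mem_nhds (gdist_pos h)] with s hs
  exact gdist_polar (normSq_angle h) hs.le

/-- Product rule for the radial derivative, one factor being radial. -/
theorem radialDeriv_radial_mul {x₀ x : Space N} (h : x ≠ x₀) {g : ℝ → ℝ} {g' : ℝ}
    (hg : HasDerivAt g g' (gdist x x₀)) {u : Space N → ℝ} (hu : DifferentiableAt ℝ u x) :
    radialDeriv x₀ (fun y => g (gdist y x₀) * u y) x =
      g' * u x + g (gdist x x₀) * radialDeriv x₀ u x := by
  rw [radialDeriv_eq_fderiv h hu]
  have h1 := hg.mul (hasDerivAt_comp_polar h hu)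
  rw [polar_angle h] at h1
  rw [← h1.deriv, radialDeriv]
  apply EventuallyEq.deriv_eq
  filter_upwards [gdist_polar_angle_eventuallyEq h] with s hs
  simp [hs]

theorem radialDeriv_radial {x₀ x : Space N} (h : x ≠ x₀) (g : ℝ → ℝ) :
    radialDeriv x₀ (fun y => g (gdist y x₀)) x = deriv g (gdist x x₀) := by
  rw [radialDeriv]
  apply EventuallyEq.deriv_eq
  filter_upwards [gdist_polar_angle_eventuallyEq h] with s hs
  rw [hs]

theorem radialDeriv_sq {x₀ x : Space N} (h : x ≠ x₀) {u : Space N → ℝ}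
    (hu : DifferentiableAt ℝ u x) :
    radialDeriv x₀ (fun y => u y ^ 2) x = 2 * u x * radialDeriv x₀ u x := by
  rw [radialDeriv_eq_fderiv h hu, radialDeriv]
  have h1 := (hasDerivAt_comp_polar h hu).fun_pow 2
  rw [h1.deriv, polar_angle h]
  simp

theorem normSq_radialGrad {x₀ x : Space N} (h : x ≠ x₀) (u : Space N → ℝ) :
    normSq x (radialGrad x₀ u x) = radialDeriv x₀ u x ^ 2 := by
  have h1 := normSq_radialField h
  rw [normSq, metric_eq] at h1 ⊢
  simp only [radialGrad, inner_smul_left, inner_smul_right, conj_trivial]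
  linear_combination radialDeriv x₀ u x ^ 2 * h1

/-! ### Differentiating the distance to the pole. -/

/-- The differential of `cosh ∘ gdist`. -/
def coshDist' (x₀ x : Space N) : Space N →L[ℝ] ℝ :=
  (√(1 + ‖x₀‖ ^ 2) / √(1 + ‖x‖ ^ 2)) • innerSL ℝ x - innerSL ℝ x₀

theorem contDiff_sqrt_one_add_norm_sq : ContDiff ℝ ∞ fun x : Space N => √(1 + ‖x‖ ^ 2) :=
  (contDiff_const.add (contDiff_norm_sq ℝ)).sqrt fun x => by positivity

theorem hasFDerivAt_sqrt_one_add_norm_sq (x : Space N) :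
    HasFDerivAt (fun y : Space N => √(1 + ‖y‖ ^ 2)) ((√(1 + ‖x‖ ^ 2))⁻¹ • innerSL ℝ x) x := by
  have h1 : HasFDerivAt (fun y : Space N => 1 + ‖y‖ ^ 2) (2 • innerSL ℝ x) x :=
    (hasStrictFDerivAt_norm_sq x).hasFDerivAt.const_add 1
  have h2 := h1.sqrt (by positivity)
  refine h2.congr_fderiv (ContinuousLinearMap.ext fun y => ?_)
  simp only [_root_.smul_apply, innerSL_apply_apply, smul_eq_mul, nsmul_eq_mul]
  push_cast
  field_simp

theorem hasFDerivAt_cosh_gdist (x₀ x : Space N) :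
    HasFDerivAt (fun y => Real.cosh (gdist y x₀)) (coshDist' x₀ x) x := by
  have h1 := ((hasFDerivAt_sqrt_one_add_norm_sq x).mul_const (√(1 + ‖x₀‖ ^ 2))).sub
    ((innerSL ℝ x₀).hasFDerivAt (x := x))
  have h2 : (fun y => Real.cosh (gdist y x₀)) =
      fun y => √(1 + ‖y‖ ^ 2) * √(1 + ‖x₀‖ ^ 2) - innerSL ℝ x₀ y := by
    funext y
    rw [cosh_gdist, innerSL_apply_apply, real_inner_comm]
  rw [h2]
  refine h1.congr_fderiv (ContinuousLinearMap.ext fun y => ?_)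
  simp only [coshDist', _root_.sub_apply, _root_.smul_apply, innerSL_apply_apply, smul_eq_mul]
  ring

/-- `arcosh` is smooth only on (1, ∞), and cosh of the distance exceeds 1 exactly off the pole. -/
theorem contDiffAt_gdist {x₀ x : Space N} (h : x ≠ x₀) :
    ContDiffAt ℝ ∞ (fun y => gdist y x₀) x := by
  have h2 : (fun y => gdist y x₀) =
      fun y => Real.arcosh (√(1 + ‖y‖ ^ 2) * √(1 + ‖x₀‖ ^ 2) - inner ℝ y x₀) := by
    funext y
    simp [gdist, minkowski, lift]
  have h3 := cosh_gdist x₀ x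
  have h4 : 1 < Real.cosh (gdist x x₀) := Real.one_lt_cosh.2 (gdist_pos h).ne'
  rw [h2]
  apply (Real.contDiffAt_arcosh (Set.mem_Ioi.2 (h3 ▸ h4))).comp x
  exact ((contDiff_sqrt_one_add_norm_sq.mul contDiff_const).sub
    (contDiff_id.inner ℝ contDiff_const)).contDiffAt

/-- Once differentiability is known, the derivative follows by differentiating cosh of the distance
in two ways and dividing by sinh. -/
theorem hasFDerivAt_gdist {x₀ x : Space N} (h : x ≠ x₀) :
    HasFDerivAt (fun y => gdist y x₀) ((Real.sinh (gdist x x₀))⁻¹ • coshDist' x₀ x) x := by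
  have h1 := ((contDiffAt_gdist h).differentiableAt (by simp)).hasFDerivAt
  have h2 := h1.cosh.unique (hasFDerivAt_cosh_gdist x₀ x)
  rw [← h2, inv_smul_smul₀ (sinh_gdist_pos h).ne']
  exact h1

/-! ### Stability of the class of test functions. -/

namespace IsTestFunction

variable {x₀ : Space N} {u v : Space N → ℝ}

/-- A function that is smooth off the pole and vanishes off the support of a test function is a
test function. -/
theorem of_eq_zero (hu : IsTestFunction x₀ u) (hv : ∀ x, x ≠ x₀ → ContDiffAt ℝ ∞ v x)
    (h0 : ∀ x, x ∉ tsupport u → v x = 0) : IsTestFunction x₀ v := by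
  have hsub : tsupport v ⊆ tsupport u :=
    closure_minimal (fun x hx => by_contra fun hxu => hx (h0 x hxu)) (isClosed_tsupport u)
  refine ⟨contDiff_iff_contDiffAt.2 fun x => ?_,
    hu.2.1.of_isClosed_subset (isClosed_tsupport v) hsub, fun h => hu.2.2 (hsub h)⟩
  by_cases hx : x = x₀
  · subst hx
    have : v =ᶠ[𝓝 x] fun _ => 0 := by
      filter_upwards [(isClosed_tsupport u).isOpen_compl.mem_nhds hu.2.2] with y hy
      exact h0 y hy
    exact contDiffAt_const.congr_of_eventuallyEq this
  · exact hv x hx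

theorem differentiableAt (hu : IsTestFunction x₀ u) (x : Space N) : DifferentiableAt ℝ u x :=
  (hu.1.differentiable (by simp)) x

theorem mul_left (hu : IsTestFunction x₀ u) (hv : ∀ x, x ≠ x₀ → ContDiffAt ℝ ∞ v x) :
    IsTestFunction x₀ fun x => v x * u x :=
  hu.of_eq_zero (fun x hx => (hv x hx).mul hu.1.contDiffAt) fun x hx => by
    simp [image_eq_zero_of_notMem_tsupport hx]

theorem sq (hu : IsTestFunction x₀ u) : IsTestFunction x₀ fun x => u x ^ 2 := by
  simpa only [pow_two] using hu.mul_left fun x _ => hu.1.contDiffAt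

theorem radial_mul (hu : IsTestFunction x₀ u) {g : ℝ → ℝ} (hg : ContDiffOn ℝ ∞ g (Set.Ioi 0)) :
    IsTestFunction x₀ fun x => g (gdist x x₀) * u x :=
  hu.mul_left fun x hx =>
    (hg.contDiffAt (Ioi_mem_nhds (gdist_pos hx))).comp x (contDiffAt_gdist hx)

theorem add (hu : IsTestFunction x₀ u) (hv : IsTestFunction x₀ v) :
    IsTestFunction x₀ fun x => u x + v x := by
  refine ⟨hu.1.add hv.1, hu.2.1.add hv.2.1, fun h => ?_⟩
  rcases tsupport_add u v h with h | h
  exacts [hu.2.2 h, hv.2.2 h]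

theorem radialDeriv_eq_zero (hu : x₀ ∉ tsupport u) {x : Space N} (hx : x ∉ tsupport u) :
    radialDeriv x₀ u x = 0 := by
  have h1 : u =ᶠ[𝓝 x] fun _ => 0 := by
    filter_upwards [(isClosed_tsupport u).isOpen_compl.mem_nhds hx] with y hy
    exact image_eq_zero_of_notMem_tsupport hy
  have h2 : Tendsto (fun s : ℝ => polar x₀ s (angle x₀ x)) (𝓝 (gdist x x₀)) (𝓝 x) := by
    have h3 : Continuous fun s : ℝ => polar x₀ s (angle x₀ x) := by
      unfold polar
      fun_prop
    have h4 := h3.tendsto (gdist x x₀)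
    by_cases h : x = x₀
    -- At the pole the inverse of sinh 0 is zero by convention, so the angle is 0 and the curve
    -- still passes through x₀ at parameter 0.
    · have h5 : gdist x₀ x₀ = 0 := by simp [gdist, minkowski_lift]
      subst h
      simpa [polar, angle, h5] using h4
    · rwa [polar_angle h] at h4
  have h6 : (fun s : ℝ => u (polar x₀ s (angle x₀ x))) =ᶠ[𝓝 (gdist x x₀)] fun _ => 0 :=
    h2.eventually h1
  rw [Hyperbolic.radialDeriv, h6.deriv_eq, deriv_const]

/-- Off the pole this is du applied to a smooth vector field; the singularity of the field at the
pole is harmless because u vanishes nearby. -/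
theorem radialDeriv (hu : IsTestFunction x₀ u) : IsTestFunction x₀ (radialDeriv x₀ u) := by
  refine hu.of_eq_zero (fun x hx => ?_) fun x hx => radialDeriv_eq_zero hu.2.2 hx
  have h1 : Hyperbolic.radialDeriv x₀ u =ᶠ[𝓝 x] fun y => fderiv ℝ u y (geodesicField x₀ y) := by
    filter_upwards [isOpen_ne.mem_nhds hx] with y hy
    exact radialDeriv_eq_fderiv hy (hu.differentiableAt y)
  refine ContDiffAt.congr_of_eventuallyEq ?_ h1
  have hd := contDiffAt_gdist hx
  have hS := (sinh_gdist_pos hx).ne'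
  refine (hu.1.fderiv_right (m := ∞) (by simp)).contDiffAt.clm_apply ?_
  unfold geodesicField
  exact ((hd.cosh.div hd.sinh hS).smul contDiffAt_id).sub ((hd.sinh.inv hS).smul contDiffAt_const)

end IsTestFunction

/-! ### Hyperbolic volume and the divergence theorem. -/

theorem integral_vol (f : Space N → ℝ) :
    ∫ x, f x ∂(vol N) = ∫ x, (1 / √(1 + ‖x‖ ^ 2)) * f x := by
  rw [vol_eq, integral_withDensity_eq_integral_toReal_smul (by fun_prop) (by simp)]
  refine integral_congr_ae (Eventually.of_forall fun x => ?_)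
  simp only [smul_eq_mul]
  rw [ENNReal.toReal_ofReal (by positivity)]

instance : IsLocallyFiniteMeasure (vol N) := by
  rw [vol_eq]
  refine IsLocallyFiniteMeasure.withDensity_ofReal ?_
  exact continuous_const.div contDiff_sqrt_one_add_norm_sq.continuous fun x => by positivity

theorem ae_volume_ne [NeZero N] (x₀ : Space N) : ∀ᵐ x : Space N, x ≠ x₀ :=
  (measure_eq_zero_iff_ae_notMem (s := {x₀})).1 (measure_singleton x₀)

theorem ae_vol_ne [NeZero N] (x₀ : Space N) : ∀ᵐ x ∂(vol N), x ≠ x₀ :=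
  (withDensity_absolutelyContinuous _ _).ae_le (ae_volume_ne x₀)

theorem IsTestFunction.integrable {x₀ : Space N} {u : Space N → ℝ} (hu : IsTestFunction x₀ u) :
    Integrable u (vol N) :=
  hu.1.continuous.integrable_of_hasCompactSupport hu.2.1

theorem vol_pos_of_isOpen {s : Set (Space N)} (hs : IsOpen s) (hne : s.Nonempty) :
    0 < vol N s := by
  have h : volume.AbsolutelyContinuous (vol N) := by
    rw [vol_eq]
    refine withDensity_absolutelyContinuous' (by fun_prop) (Eventually.of_forall fun x => ?_)
    rw [ne_eq, ENNReal.ofReal_eq_zero, not_le]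
    positivity
  exact pos_iff_ne_zero.2 fun h0 => (hs.measure_pos volume hne).ne' (h h0)

/-- Integration by parts against the constant function 1. -/
theorem integral_fderiv_apply_eq_zero {q : Space N → ℝ} (hq : ContDiff ℝ ∞ q)
    (hc : HasCompactSupport q) (a : Space N) : ∫ x, fderiv ℝ q x a = 0 := by
  have hq' : Continuous fun x => fderiv ℝ q x a :=
    (hq.continuous_fderiv (by simp)).clm_apply continuous_const
  have h := integral_mul_fderiv_eq_neg_fderiv_mul_of_integrable (μ := volume) (𝕜 := ℝ)
    (f := fun _ : Space N => (1 : ℝ)) (g := q) (v := a) (by simp)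
    (by simpa using hq'.integrable_of_hasCompactSupport (hc.fderiv_apply ℝ a))
    (by simpa using hq.continuous.integrable_of_hasCompactSupport hc)
    (fun x _ => by fun_prop) (fun x _ => (hq.differentiable (by simp)) x)
  simpa using h

/-- The divergence of the field `q(x) x` has integral zero. -/
theorem integral_div_smul_id {q : Space N → ℝ} (hq : ContDiff ℝ ∞ q)
    (hc : HasCompactSupport q) : ∫ x, (N * q x + fderiv ℝ q x x) = 0 := by
  have hq' (a : Space N) : Continuous fun x => fderiv ℝ q x a :=
    (hq.continuous_fderiv (by simp)).clm_apply continuous_const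
  have hqi := hq.continuous.integrable_of_hasCompactSupport (μ := volume) hc
  have hi (i : Fin N) : Integrable fun x : Space N =>
      x i * fderiv ℝ q x (EuclideanSpace.single i 1) :=
    ((by fun_prop : Continuous fun x : Space N => x i).mul (hq' _)).integrable_of_hasCompactSupport
      ((hc.fderiv_apply ℝ _).mul_left)
  have hd (i : Fin N) (x : Space N) : fderiv ℝ (fun x : Space N => x i) x
      (EuclideanSpace.single i 1) = 1 := by
    have h : HasFDerivAt (fun x : Space N => x i) (EuclideanSpace.proj (𝕜 := ℝ) i) x :=
      (EuclideanSpace.proj (𝕜 := ℝ) i).hasFDerivAt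
    rw [h.fderiv]
    simp
  -- Integration by parts against the i-th coordinate function, whose i-th partial derivative is 1.
  have h (i : Fin N) : ∫ x : Space N, x i * fderiv ℝ q x (EuclideanSpace.single i 1) =
      -∫ x, q x := by
    have h := integral_mul_fderiv_eq_neg_fderiv_mul_of_integrable (μ := volume) (𝕜 := ℝ)
      (f := fun x : Space N => x i) (g := q) (v := EuclideanSpace.single i 1)
      (by simpa [hd] using hqi) (hi i)
      (((by fun_prop : Continuous fun x : Space N => x i).mul
        hq.continuous).integrable_of_hasCompactSupport hc.mul_left)
      (fun x _ => by fun_prop) (fun x _ => (hq.differentiable (by simp)) x)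
    simpa [hd] using h
  have hs (x : Space N) : fderiv ℝ q x x =
      ∑ i, x i * fderiv ℝ q x (EuclideanSpace.single i 1) := by
    have hx := (EuclideanSpace.basisFun (Fin N) ℝ).sum_repr x
    conv_lhs => rw [← hx, map_sum, hx]
    simp
  simp_rw [hs]
  rw [integral_add (hqi.const_mul _) (integrable_finsetSum _ fun i _ => hi i),
    integral_finsetSum _ fun i _ => hi i, integral_const_mul]
  simp [h]

/-- Pointwise form of the divergence theorem for radial fields: in the chart, the Euclidean
divergence of `ρ p ∂/∂r` is `ρ (p_r + (N - 1) coth r p)`. -/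
theorem radial_divergence {x₀ x : Space N} (h : x ≠ x₀) {p : Space N → ℝ}
    (hp : DifferentiableAt ℝ p x) :
    let q := fun y => Real.cosh (gdist y x₀) * (√(1 + ‖y‖ ^ 2) * Real.sinh (gdist y x₀))⁻¹ * p y
    let s := fun y => (√(1 + ‖y‖ ^ 2) * Real.sinh (gdist y x₀))⁻¹ * p y
    N * q x + fderiv ℝ q x x - fderiv ℝ s x x₀ = 1 / √(1 + ‖x‖ ^ 2) *
      (radialDeriv x₀ p x + (N - 1) * coth (gdist x x₀) * p x) := by
  intro q s
  have hS := (sinh_gdist_pos h).ne'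
  have hA : √(1 + ‖x‖ ^ 2) ≠ 0 := by positivity
  have dA := hasFDerivAt_sqrt_one_add_norm_sq x
  have dK := hasFDerivAt_cosh_gdist x₀ x
  have dS := (hasFDerivAt_gdist h).sinh
  have dI := (hasDerivAt_inv (mul_ne_zero hA hS)).comp_hasFDerivAt x (dA.fun_mul dS)
  have hq : fderiv ℝ q x = _ := ((dK.fun_mul dI).fun_mul hp.hasFDerivAt).fderiv
  have hs : fderiv ℝ s x = _ := (dI.fun_mul hp.hasFDerivAt).fderiv
  have hx : (inner ℝ x x : ℝ) = √(1 + ‖x‖ ^ 2) ^ 2 - 1 := by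
    rw [Real.sq_sqrt (by positivity), real_inner_self_eq_norm_sq]
    ring
  have hx₀ : (inner ℝ x₀ x₀ : ℝ) = √(1 + ‖x₀‖ ^ 2) ^ 2 - 1 := by
    rw [Real.sq_sqrt (by positivity), real_inner_self_eq_norm_sq]
    ring
  have hxx₀ : (inner ℝ x x₀ : ℝ) =
      √(1 + ‖x‖ ^ 2) * √(1 + ‖x₀‖ ^ 2) - Real.cosh (gdist x x₀) := by
    rw [cosh_gdist]
    ring
  have hc := Real.cosh_sq (gdist x x₀)
  rw [hq, hs, radialDeriv_eq_fderiv h hp]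
  simp only [q, geodesicField, coshDist', coth, Function.comp_apply, _root_.add_apply,
    _root_.smul_apply, _root_.sub_apply, smul_eq_mul, map_sub, map_smul, innerSL_apply_apply,
    real_inner_comm x x₀, hx, hx₀, hxx₀]
  -- All inner products are now expressed through A = √(1 + |x|²), B = √(1 + |x₀|²) and K = cosh r.
  -- What remains is a rational identity modulo S² = K² - 1.
  generalize Real.sinh (gdist x x₀) = S at *
  generalize Real.cosh (gdist x x₀) = K at *
  generalize √(1 + ‖x‖ ^ 2) = A at *
  generalize √(1 + ‖x₀‖ ^ 2) = B at *
  generalize fderiv ℝ p x x = P at *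
  generalize fderiv ℝ p x x₀ = P₀ at *
  generalize p x = Q at *
  have hK : S ^ 2 = K ^ 2 - 1 := by linarith
  field_simp
  ring_nf
  simp only [hK]
  ring

/-- The divergence theorem for radial fields. -/
theorem integral_radial_divergence [NeZero N] {x₀ : Space N} {p : Space N → ℝ}
    (hp : IsTestFunction x₀ p) :
    ∫ x, (radialDeriv x₀ p x + (N - 1) * coth (gdist x x₀) * p x) ∂(vol N) = 0 := by
  -- With density 1/A and ∂/∂r = (K/S) x - (1/S) x₀, the weighted field is q(x) x - s(x) x₀. Both
  -- coefficients are test functions, so the two Euclidean integrals vanish separately.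
  have hA (y : Space N) : √(1 + ‖y‖ ^ 2) ≠ 0 := by positivity
  have hq : IsTestFunction x₀ fun y =>
      Real.cosh (gdist y x₀) * (√(1 + ‖y‖ ^ 2) * Real.sinh (gdist y x₀))⁻¹ * p y :=
    hp.mul_left fun y hy => (contDiffAt_gdist hy).cosh.mul
      ((contDiff_sqrt_one_add_norm_sq.contDiffAt.mul (contDiffAt_gdist hy).sinh).inv
        (mul_ne_zero (hA y) (sinh_gdist_pos hy).ne'))
  have hs : IsTestFunction x₀ fun y =>
      (√(1 + ‖y‖ ^ 2) * Real.sinh (gdist y x₀))⁻¹ * p y :=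
    hp.mul_left fun y hy =>
      (contDiff_sqrt_one_add_norm_sq.contDiffAt.mul (contDiffAt_gdist hy).sinh).inv
      (mul_ne_zero (hA y) (sinh_gdist_pos hy).ne')
  have h1 := integral_div_smul_id hq.1 hq.2.1
  have h2 := integral_fderiv_apply_eq_zero hs.1 hs.2.1 x₀
  have i2 : Integrable fun x => fderiv ℝ (fun y =>
      (√(1 + ‖y‖ ^ 2) * Real.sinh (gdist y x₀))⁻¹ * p y) x x₀ :=
    ((hs.1.continuous_fderiv (by simp)).clm_apply
      continuous_const).integrable_of_hasCompactSupport (hs.2.1.fderiv_apply ℝ x₀)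
  have i1 : Integrable fun x => N * (Real.cosh (gdist x x₀) *
      (√(1 + ‖x‖ ^ 2) * Real.sinh (gdist x x₀))⁻¹ * p x) + fderiv ℝ (fun y =>
        Real.cosh (gdist y x₀) * (√(1 + ‖y‖ ^ 2) * Real.sinh (gdist y x₀))⁻¹ * p y) x x := by
    refine Continuous.integrable_of_hasCompactSupport ((continuous_const.mul hq.1.continuous).add
      ((hq.1.continuous_fderiv (by simp)).clm_apply continuous_id)) (hq.2.1.mul_left.add ?_)
    exact (hq.2.1.fderiv ℝ).mono fun x hx h0 => hx (DFunLike.congr_fun h0 x)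
  have h3 := integral_sub i1 i2
  rw [h1, h2, sub_zero] at h3
  rw [integral_vol, ← h3]
  refine integral_congr_ae ?_
  filter_upwards [ae_volume_ne x₀] with x hx
  exact (radial_divergence hx (hp.differentiableAt x)).symm

/-! ### The weight Ψ and its Riccati equation. -/

/-- The logarithmic derivative of `Psi`. -/
def logDerivPsi (N : ℕ) (lam r : ℝ) : ℝ :=
  hN N lam / r - ((N : ℝ) - 1 + gam N lam) / 2 * coth r

theorem hasDerivAt_coth {r : ℝ} (hr : 0 < r) :
    HasDerivAt coth (-1 / Real.sinh r ^ 2) r := by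
  have hS := (Real.sinh_pos_iff.2 hr).ne'
  refine ((Real.hasDerivAt_cosh r).fun_div (Real.hasDerivAt_sinh r) hS).congr_deriv ?_
  have := Real.cosh_sq r
  congr 1
  linarith

theorem Psi_pos (N : ℕ) (lam : ℝ) {r : ℝ} (hr : 0 < r) : 0 < Psi N lam r :=
  mul_pos (Real.rpow_pos_of_pos hr _)
    (Real.rpow_pos_of_pos (div_pos (Real.sinh_pos_iff.2 hr) hr) _)

theorem hasDerivAt_Psi (N : ℕ) (lam : ℝ) {r : ℝ} (hr : 0 < r) :
    HasDerivAt (Psi N lam) (logDerivPsi N lam r * Psi N lam r) r := by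
  have hS := Real.sinh_pos_iff.2 hr
  have hq := div_pos hS hr
  have h1 := (hasDerivAt_id r).rpow_const (p := -(((N : ℝ) - 2) / 2)) (Or.inl hr.ne')
  have h2 := ((Real.hasDerivAt_sinh r).fun_div (hasDerivAt_id r) hr.ne').rpow_const
    (p := -(((N : ℝ) - 1 + gam N lam) / 2)) (Or.inl hq.ne')
  refine (h1.mul h2).congr_deriv ?_
  simp only [id_eq, Psi, logDerivPsi, coth, hN]
  rw [Real.rpow_sub_one hr.ne', Real.rpow_sub_one hq.ne']
  field_simp
  ring

theorem contDiffOn_coth : ContDiffOn ℝ ∞ coth (Set.Ioi 0) :=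
  Real.contDiff_cosh.contDiffOn.div Real.contDiff_sinh.contDiffOn
    fun _ hr => (Real.sinh_pos_iff.2 hr).ne'

theorem contDiffOn_Psi (N : ℕ) (lam : ℝ) : ContDiffOn ℝ ∞ (Psi N lam) (Set.Ioi 0) := by
  have h0 (r : ℝ) (hr : r ∈ Set.Ioi (0 : ℝ)) : r ≠ 0 := (Set.mem_Ioi.1 hr).ne'
  exact (contDiffOn_id.rpow_const_of_ne h0).mul
    ((Real.contDiff_sinh.contDiffOn.div contDiffOn_id h0).rpow_const_of_ne
      fun r hr => (div_pos (Real.sinh_pos_iff.2 hr) hr).ne')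

theorem contDiffOn_logDerivPsi (N : ℕ) (lam : ℝ) :
    ContDiffOn ℝ ∞ (logDerivPsi N lam) (Set.Ioi 0) :=
  (contDiffOn_const.div contDiffOn_id fun _ hr => (Set.mem_Ioi.1 hr).ne').sub
    (contDiffOn_const.mul contDiffOn_coth)

theorem hasDerivAt_logDerivPsi (N : ℕ) (lam : ℝ) {r : ℝ} (hr : 0 < r) :
    HasDerivAt (logDerivPsi N lam)
      (-hN N lam / r ^ 2 + ((N : ℝ) - 1 + gam N lam) / 2 / Real.sinh r ^ 2) r := by
  refine (((hasDerivAt_const r (hN N lam)).fun_div (hasDerivAt_id r) hr.ne').sub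
    ((hasDerivAt_coth hr).const_mul (((N : ℝ) - 1 + gam N lam) / 2))).congr_deriv ?_
  simp only [id_eq]
  ring

theorem gam_sq {lam : ℝ} (hlam : lam ≤ (((N : ℝ) - 1) / 2) ^ 2) :
    gam N lam ^ 2 = ((N : ℝ) - 1) ^ 2 - 4 * lam :=
  Real.sq_sqrt (by linarith)

/-- The Riccati equation satisfied by the logarithmic derivative of `Psi`. -/
theorem riccati_logDerivPsi {lam : ℝ} (hlam : lam ≤ (((N : ℝ) - 1) / 2) ^ 2) {r : ℝ}
    (hr : 0 < r) :
    (((N : ℝ) - 1) * coth r) ^ 2 - logDerivPsi N lam r ^ 2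
      - (((N : ℝ) - 1) * (-1 / Real.sinh r ^ 2) +
        (-hN N lam / r ^ 2 + ((N : ℝ) - 1 + gam N lam) / 2 / Real.sinh r ^ 2))
      - ((N : ℝ) - 1) * coth r * (((N : ℝ) - 1) * coth r + logDerivPsi N lam r) =
    lam + hN N lam ^ 2 / r ^ 2 + (((N : ℝ) / 2) ^ 2 - hN N lam ^ 2) / Real.sinh r ^ 2
      + gam N lam * hN N lam * ((r * coth r - 1) / r ^ 2) := by
  have hS := (Real.sinh_pos_iff.2 hr).ne'
  have hg := gam_sq hlam
  have hc : coth r ^ 2 = 1 + 1 / Real.sinh r ^ 2 := by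
    rw [coth, div_pow, Real.cosh_sq]
    field_simp
  have hd : (r * coth r - 1) / r ^ 2 = coth r / r - 1 / r ^ 2 := by
    field_simp
  rw [hd, logDerivPsi, hN]
  -- Write k = (N - 1 + γ) / 2. The coth² terms carry k(N - 1 - k) = λ, and the coth r / r terms
  -- carry h(2k - (N - 1)) = γh. The 1/r² terms match because 2h = γ + 1.
  linear_combination (((N : ℝ) - 1) * (((N : ℝ) - 1 + gam N lam) / 2)
    - (((N : ℝ) - 1 + gam N lam) / 2) ^ 2) * hc - 1 / 4 * hg

/-! ### The integral identity. -/

theorem radialLaplacian_eq {x₀ x : Space N} (h : x ≠ x₀) (hN : 1 ≤ N) {u : Space N → ℝ}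
    (hu : DifferentiableAt ℝ (radialDeriv x₀ u) x) :
    radialLaplacian x₀ u x = radialDeriv x₀ (radialDeriv x₀ u) x +
      (N - 1) * coth (gdist x x₀) * radialDeriv x₀ u x := by
  have hS := (sinh_gdist_pos h).ne'
  have h1 := (Real.hasDerivAt_sinh (gdist x x₀)).fun_pow (N - 1)
  rw [radialLaplacian,
    radialDeriv_radial_mul h (g := fun r => Real.sinh r ^ (N - 1)) h1 hu, coth]
  -- Differentiating the power produces the exponent N - 1 - 1, which is truncated at N = 1; there
  -- the factor N - 1 vanishes.
  rcases hN.lt_or_eq with hN | rfl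
  · obtain ⟨M, rfl⟩ : ∃ M, N = M + 2 := ⟨N - 2, by omega⟩
    simp only [show M + 2 - 1 = M + 1 by omega, Nat.add_sub_cancel]
    push_cast
    field_simp
    ring
  · simp

theorem radialDeriv_div_Psi {x₀ x : Space N} (h : x ≠ x₀) (lam : ℝ) {v : Space N → ℝ}
    (hv : DifferentiableAt ℝ v x) :
    Psi N lam (gdist x x₀) ^ 2 *
      normSq x (radialGrad x₀ (fun y => v y / Psi N lam (gdist y x₀)) x) =
    (radialDeriv x₀ v x - logDerivPsi N lam (gdist x x₀) * v x) ^ 2 := by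
  have hP := (Psi_pos N lam (gdist_pos h)).ne'
  have h1 := radialDeriv_radial_mul h (g := fun r => (Psi N lam r)⁻¹)
    ((hasDerivAt_Psi N lam (gdist_pos h)).fun_inv hP) hv
  simp only [normSq_radialGrad h, div_eq_inv_mul]
  rw [h1]
  field_simp
  ring

/-- A quadratic radial-multiplier term built from a test function is integrable. -/
theorem integrable_radial_mul_sq {x₀ : Space N} {v : Space N → ℝ} (hv : IsTestFunction x₀ v)
    {g : ℝ → ℝ} (hg : ContDiffOn ℝ ∞ g (Set.Ioi 0)) :
    Integrable (fun x => g (gdist x x₀) * v x ^ 2) (vol N) :=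
  (hv.sq.radial_mul hg).integrable

theorem integral_congr_off_pole [NeZero N] (x₀ : Space N) {f g : Space N → ℝ}
    (h : ∀ x, x ≠ x₀ → f x = g x) : ∫ x, f x ∂(vol N) = ∫ x, g x ∂(vol N) :=
  integral_congr_ae ((ae_vol_ne x₀).mono h)

theorem integral_linear_combination {α : Type*} [MeasurableSpace α] {μ : Measure α}
    {f f₁ f₂ f₃ f₄ f₅ f₆ : α → ℝ} {a b c d : ℝ} (h₁ : Integrable f₁ μ) (h₂ : Integrable f₂ μ)
    (h₃ : Integrable f₃ μ) (h₄ : Integrable f₄ μ) (h₅ : Integrable f₅ μ) (h₆ : Integrable f₆ μ)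
    (h : ∀ᵐ x ∂μ, f x = a * f₁ x + b * f₂ x + c * f₃ x + d * f₄ x + f₅ x + f₆ x) :
    ∫ x, f x ∂μ = a * ∫ x, f₁ x ∂μ + b * ∫ x, f₂ x ∂μ + c * ∫ x, f₃ x ∂μ + d * ∫ x, f₄ x ∂μ
      + ∫ x, f₅ x ∂μ + ∫ x, f₆ x ∂μ := by
  have k₂ : Integrable (fun x => a * f₁ x + b * f₂ x) μ := (h₁.const_mul a).add (h₂.const_mul b)
  have k₃ : Integrable (fun x => a * f₁ x + b * f₂ x + c * f₃ x) μ := k₂.add (h₃.const_mul c)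
  have k₄ : Integrable (fun x => a * f₁ x + b * f₂ x + c * f₃ x + d * f₄ x) μ :=
    k₃.add (h₄.const_mul d)
  have k₅ : Integrable (fun x => a * f₁ x + b * f₂ x + c * f₃ x + d * f₄ x + f₅ x) μ := k₄.add h₅
  rw [integral_congr_ae h, integral_add k₅ h₆, integral_add k₄ h₅,
    integral_add k₃ (h₄.const_mul d), integral_add k₂ (h₃.const_mul c),
    integral_add (h₁.const_mul a) (h₂.const_mul b)]
  simp only [integral_const_mul]

theorem integral_radialLaplacian_sq [NeZero N] {x₀ : Space N} {lam : ℝ}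
    (hlam : lam ≤ (((N : ℝ) - 1) / 2) ^ 2) {u : Space N → ℝ} (hu : IsTestFunction x₀ u) :
    ∫ x, |radialLaplacian x₀ u x| ^ 2 ∂(vol N) =
        lam * ∫ x, normSq x (radialGrad x₀ u x) ∂(vol N)
        + hN N lam ^ 2 * ∫ x, normSq x (radialGrad x₀ u x) / gdist x x₀ ^ 2 ∂(vol N)
        + (((N : ℝ) / 2) ^ 2 - hN N lam ^ 2) *
            ∫ x, normSq x (radialGrad x₀ u x) / Real.sinh (gdist x x₀) ^ 2 ∂(vol N)
        + gam N lam * hN N lam *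
            ∫ x, (gdist x x₀ * coth (gdist x x₀) - 1) / gdist x x₀ ^ 2
              * normSq x (radialGrad x₀ u x) ∂(vol N)
        + ∫ x, Psi N lam (gdist x x₀) ^ 2
              * normSq x (radialGrad x₀
                  (fun y => radialDeriv x₀ u y / Psi N lam (gdist y x₀)) x) ∂(vol N) := by
  have hN1 : 1 ≤ N := NeZero.one_le
  set v := radialDeriv x₀ u with hvdef
  have hv : IsTestFunction x₀ v := hu.radialDeriv
  have hne (r : ℝ) (hr : r ∈ Set.Ioi (0 : ℝ)) : r ≠ 0 := (Set.mem_Ioi.1 hr).ne'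
  have hSne (r : ℝ) (hr : r ∈ Set.Ioi (0 : ℝ)) : Real.sinh r ≠ 0 := (Real.sinh_pos_iff.2 hr).ne'
  have e1 : ∫ x, normSq x (radialGrad x₀ u x) ∂(vol N) = ∫ x, v x ^ 2 ∂(vol N) :=
    integral_congr_off_pole x₀ fun x hx => normSq_radialGrad hx u
  have e2 : ∫ x, normSq x (radialGrad x₀ u x) / gdist x x₀ ^ 2 ∂(vol N) =
      ∫ x, 1 / gdist x x₀ ^ 2 * v x ^ 2 ∂(vol N) :=
    integral_congr_off_pole x₀ fun x hx => by rw [normSq_radialGrad hx u]; ring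
  have e3 : ∫ x, normSq x (radialGrad x₀ u x) / Real.sinh (gdist x x₀) ^ 2 ∂(vol N) =
      ∫ x, 1 / Real.sinh (gdist x x₀) ^ 2 * v x ^ 2 ∂(vol N) :=
    integral_congr_off_pole x₀ fun x hx => by rw [normSq_radialGrad hx u]; ring
  have e4 : ∫ x, (gdist x x₀ * coth (gdist x x₀) - 1) / gdist x x₀ ^ 2
        * normSq x (radialGrad x₀ u x) ∂(vol N) =
      ∫ x, (gdist x x₀ * coth (gdist x x₀) - 1) / gdist x x₀ ^ 2 * v x ^ 2 ∂(vol N) :=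
    integral_congr_off_pole x₀ fun x hx => by rw [normSq_radialGrad hx u]
  have e5 : ∫ x, Psi N lam (gdist x x₀) ^ 2
        * normSq x (radialGrad x₀ (fun y => v y / Psi N lam (gdist y x₀)) x) ∂(vol N) =
      ∫ x, (radialDeriv x₀ v x + -logDerivPsi N lam (gdist x x₀) * v x) ^ 2 ∂(vol N) :=
    integral_congr_off_pole x₀ fun x hx => by
      rw [radialDeriv_div_Psi hx lam (hv.differentiableAt x)]
      ring
  have i1 : Integrable (fun x => v x ^ 2) (vol N) := hv.sq.integrable
  have i2 := integrable_radial_mul_sq hv (g := fun r => 1 / r ^ 2)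
    (contDiffOn_const.div (contDiffOn_id.pow 2) fun r hr => pow_ne_zero 2 (hne r hr))
  have i3 := integrable_radial_mul_sq hv (g := fun r => 1 / Real.sinh r ^ 2)
    (contDiffOn_const.div (Real.contDiff_sinh.contDiffOn.pow 2)
      fun r hr => pow_ne_zero 2 (hSne r hr))
  have i4 := integrable_radial_mul_sq hv (g := fun r => (r * coth r - 1) / r ^ 2)
    (((contDiffOn_id.mul contDiffOn_coth).sub contDiffOn_const).div (contDiffOn_id.pow 2)
      fun r hr => pow_ne_zero 2 (hne r hr))
  have i5 := (hv.radialDeriv.add (hv.radial_mul (contDiffOn_logDerivPsi N lam).neg)).sq.integrable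
  have hβ : ContDiffOn ℝ ∞ (fun r => ((N : ℝ) - 1) * coth r + logDerivPsi N lam r) (Set.Ioi 0) :=
    (contDiffOn_const.mul contDiffOn_coth).add (contDiffOn_logDerivPsi N lam)
  have hp := hv.sq.radial_mul hβ
  have i6 : Integrable (fun x => radialDeriv x₀ (fun x => (((N : ℝ) - 1) * coth (gdist x x₀) +
      logDerivPsi N lam (gdist x x₀)) * v x ^ 2) x + (N - 1) * coth (gdist x x₀) *
        ((((N : ℝ) - 1) * coth (gdist x x₀) + logDerivPsi N lam (gdist x x₀)) * v x ^ 2)) (vol N) :=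
    (hp.radialDeriv.add (hp.radial_mul (g := fun r => ((N : ℝ) - 1) * coth r)
      (contDiffOn_const.mul contDiffOn_coth))).integrable
  have h0 := integral_radial_divergence hp
  -- The zero added on the right is the integral of the divergence of β v² ∂/∂r. With it the
  -- integrands agree pointwise off the pole, by the Riccati equation.
  rw [e1, e2, e3, e4, e5, ← add_zero (_ + ∫ x, _ ∂(vol N)), ← h0]
  refine integral_linear_combination i1 i2 i3 i4 i5 i6 ((ae_vol_ne x₀).mono fun x hx => ?_)
  have hr := gdist_pos hx
  rw [radialLaplacian_eq hx hN1 (hv.differentiableAt x), sq_abs, ← hvdef,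
    radialDeriv_radial_mul hx (g := fun r => ((N : ℝ) - 1) * coth r + logDerivPsi N lam r)
      (((hasDerivAt_coth hr).const_mul _).fun_add (hasDerivAt_logDerivPsi N lam hr))
      (hv.sq.differentiableAt x), radialDeriv_sq hx (hv.differentiableAt x)]
  have hR := riccati_logDerivPsi hlam hr
  linear_combination v x ^ 2 * hR

/-! ### Bumps on the half-line and radial test functions. -/

/-- Smooth functions on the line supported in `[a, b]`. -/
structure IsBump (a b : ℝ) (f : ℝ → ℝ) : Prop where
  smooth : ContDiff ℝ ∞ f
  zero : ∀ r, r ∉ Set.Icc a b → f r = 0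

namespace IsBump

variable {a b : ℝ} {f g : ℝ → ℝ}

theorem mono (hf : IsBump a b f) {a' b' : ℝ} (ha : a' ≤ a) (hb : b ≤ b') : IsBump a' b' f :=
  ⟨hf.smooth, fun r hr => hf.zero r fun h => hr (Set.Icc_subset_Icc ha hb h)⟩

theorem add (hf : IsBump a b f) (hg : IsBump a b g) : IsBump a b fun r => f r + g r :=
  ⟨hf.smooth.add hg.smooth, fun r hr => by rw [hf.zero r hr, hg.zero r hr, add_zero]⟩

theorem const_mul (hf : IsBump a b f) (c : ℝ) : IsBump a b fun r => c * f r :=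
  ⟨contDiff_const.mul hf.smooth, fun r hr => by rw [hf.zero r hr, mul_zero]⟩

theorem sq (hf : IsBump a b f) : IsBump a b fun r => f r ^ 2 :=
  ⟨hf.smooth.pow 2, fun r hr => by simp [hf.zero r hr]⟩

theorem eventually_zero (hf : IsBump a b f) {r : ℝ} (hr : r ∉ Set.Icc a b) :
    f =ᶠ[𝓝 r] fun _ => 0 :=
  Filter.mem_of_superset (isClosed_Icc.isOpen_compl.mem_nhds hr) hf.zero

theorem deriv (hf : IsBump a b f) : IsBump a b (deriv f) :=
  ⟨((contDiff_infty_iff_deriv).1 hf.smooth).2, fun r hr => by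
    rw [(hf.eventually_zero hr).deriv_eq, deriv_const]⟩

theorem radial_mul (hf : IsBump a b f) (ha : 0 < a) (hg : ContDiffOn ℝ ∞ g (Set.Ioi 0)) :
    IsBump a b fun r => g r * f r := by
  refine ⟨contDiff_iff_contDiffAt.2 fun r => ?_, fun r hr => by rw [hf.zero r hr, mul_zero]⟩
  rcases lt_or_ge 0 r with hr | hr
  · exact (hg.contDiffAt (Ioi_mem_nhds hr)).mul hf.smooth.contDiffAt
  · have h0 : (fun r => g r * f r) =ᶠ[𝓝 r] fun _ => 0 :=
      (hf.eventually_zero fun h => (ha.trans_le h.1).not_ge hr).mono fun s hs => by simp [hs]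
    exact contDiffAt_const.congr_of_eventuallyEq h0

/-- A function that is smooth on `(0, ∞)` and supported there in `[a, b]`, extended by zero. -/
theorem indicator (ha : 0 < a) (hg : ContDiffOn ℝ ∞ g (Set.Ioi 0))
    (h0 : ∀ r, 0 < r → r ∉ Set.Icc a b → g r = 0) : IsBump a b ((Set.Ioi 0).indicator g) := by
  refine ⟨contDiff_iff_contDiffAt.2 fun r => ?_, fun r hr => ?_⟩
  · rcases lt_or_ge 0 r with hr | hr
    · refine (hg.contDiffAt (Ioi_mem_nhds hr)).congr_of_eventuallyEq ?_
      filter_upwards [Ioi_mem_nhds hr] with s hs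
      exact Set.indicator_of_mem hs g
    · have h1 : (Set.Ioi 0).indicator g =ᶠ[𝓝 r] fun _ => 0 := by
        filter_upwards [Iio_mem_nhds (hr.trans_lt ha)] with s hs
        by_cases hs0 : s ∈ Set.Ioi (0 : ℝ)
        · rw [Set.indicator_of_mem hs0]
          exact h0 s hs0 fun h => (not_lt.2 h.1) hs
        · exact Set.indicator_of_notMem hs0 g
      exact contDiffAt_const.congr_of_eventuallyEq h1
  · by_cases hr0 : r ∈ Set.Ioi (0 : ℝ)
    · rw [Set.indicator_of_mem hr0]
      exact h0 r hr0 hr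
    · exact Set.indicator_of_notMem hr0 g

theorem integrable (hf : IsBump a b f) : Integrable f :=
  hf.smooth.continuous.integrable_of_hasCompactSupport
    (HasCompactSupport.intro isCompact_Icc hf.zero)

theorem integral_eq (hf : IsBump a b f) (hab : a ≤ b) : ∫ r, f r = ∫ r in a..b, f r := by
  rw [intervalIntegral.integral_of_le hab, ← integral_Icc_eq_integral_Ioc,
    setIntegral_eq_integral_of_forall_compl_eq_zero hf.zero]

/-- The primitive based at a vanishes to the left of the support, and to its right it equals the
total integral, which is zero. -/
theorem exists_primitive (hf : IsBump a b f) (h0 : ∫ r, f r = 0) :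
    ∃ F, IsBump a b F ∧ ∀ r, HasDerivAt F (f r) r := by
  have hd (r : ℝ) : HasDerivAt (fun r => ∫ s in a..r, f s) (f r) r :=
    hf.smooth.continuous.integral_hasStrictDerivAt a r |>.hasDerivAt
  refine ⟨fun r => ∫ s in a..r, f s, ⟨?_, fun r hr => ?_⟩, hd⟩
  · refine contDiff_infty_iff_deriv.2 ⟨fun r => (hd r).differentiableAt, ?_⟩
    rw [show _root_.deriv (fun r => ∫ s in a..r, f s) = f from funext fun r => (hd r).deriv]
    exact hf.smooth
  · rcases lt_or_ge r a with h | h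
    · rw [intervalIntegral.integral_symm, intervalIntegral.integral_of_le h.le,
        integral_Ioc_eq_integral_Ioo, setIntegral_eq_zero_of_forall_eq_zero, neg_zero]
      exact fun s hs => hf.zero s fun h => h.1.not_gt hs.2
    · have hb : b < r := lt_of_not_ge fun hb => hr ⟨h, hb⟩
      rw [← (hf.mono le_rfl hb.le).integral_eq h, h0]

end IsBump

theorem isTestFunction_radial (x₀ : Space N) {a b : ℝ} (ha : 0 < a) (hab : a ≤ b) {f : ℝ → ℝ}
    (hf : IsBump a b f) : IsTestFunction x₀ fun x => f (gdist x x₀) := by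
  have hKc : Continuous fun x : Space N => Real.cosh (gdist x x₀) :=
    continuous_iff_continuousAt.2 fun x => (hasFDerivAt_cosh_gdist x₀ x).continuousAt
  have hg0 : gdist x₀ x₀ = 0 := by simp [gdist, minkowski_lift]
  have hgn (x : Space N) : 0 ≤ gdist x x₀ := by
    by_cases hx : x = x₀
    · rw [hx, hg0]
    · exact (gdist_pos hx).le
  have hcl : IsClosed {x : Space N | gdist x x₀ ∈ Set.Icc a b} := by
    have : {x : Space N | gdist x x₀ ∈ Set.Icc a b} =
        (fun x => Real.cosh (gdist x x₀)) ⁻¹' Set.Icc (Real.cosh a) (Real.cosh b) := by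
      ext x
      simp only [Set.mem_ofPred_eq, Set.mem_preimage, Set.mem_Icc, Real.cosh_le_cosh,
        abs_of_pos ha, abs_of_nonneg (hgn x), abs_of_nonneg (ha.le.trans hab)]
    rw [this]
    exact isClosed_Icc.preimage hKc
  -- Compactness of the annulus: cosh d(x, x₀) ≥ |x| (√(1 + |x₀|²) - |x₀|), so a bound on the
  -- distance bounds |x|.
  have hB : 0 < √(1 + ‖x₀‖ ^ 2) - ‖x₀‖ := by
    have := Real.lt_sqrt_of_sq_lt (show ‖x₀‖ ^ 2 < 1 + ‖x₀‖ ^ 2 by linarith)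
    linarith
  have hK : IsCompact {x : Space N | gdist x x₀ ∈ Set.Icc a b} := by
    refine (isCompact_closedBall (0 : Space N)
      (Real.cosh b / (√(1 + ‖x₀‖ ^ 2) - ‖x₀‖))).of_isClosed_subset hcl fun x hx => ?_
    rw [mem_closedBall_zero_iff, le_div_iff₀ hB]
    have h1 : Real.cosh (gdist x x₀) ≤ Real.cosh b := by
      rw [Real.cosh_le_cosh, abs_of_nonneg (hgn x), abs_of_nonneg (ha.le.trans hab)]
      exact hx.2
    rw [cosh_gdist] at h1
    have h2 := real_inner_le_norm x x₀
    have h3 := Real.le_sqrt_of_sq_le (show ‖x‖ ^ 2 ≤ 1 + ‖x‖ ^ 2 by linarith)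
    have h4 := mul_le_mul_of_nonneg_right h3 (Real.sqrt_nonneg (1 + ‖x₀‖ ^ 2))
    linarith
  have hsub : tsupport (fun x => f (gdist x x₀)) ⊆ {x : Space N | gdist x x₀ ∈ Set.Icc a b} :=
    closure_minimal (fun x hx => by_contra fun h => hx (hf.zero _ h)) hcl
  have hx₀ : x₀ ∉ {x : Space N | gdist x x₀ ∈ Set.Icc a b} := fun h => by
    have := h.1
    rw [hg0] at this
    linarith
  refine ⟨contDiff_iff_contDiffAt.2 fun x => ?_, hK.of_isClosed_subset (isClosed_tsupport _) hsub,
    fun h => hx₀ (hsub h)⟩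
  by_cases hx : x = x₀
  · have h0 : (fun x => f (gdist x x₀)) =ᶠ[𝓝 x] fun _ => 0 := by
      filter_upwards [hcl.isOpen_compl.mem_nhds (hx ▸ hx₀)] with y hy
      exact hf.zero _ hy
    exact contDiffAt_const.congr_of_eventuallyEq h0
  · exact hf.smooth.contDiffAt.comp x (contDiffAt_gdist hx)

theorem exists_gdist_eq [NeZero N] (x₀ : Space N) {r : ℝ} (hr : 0 ≤ r) :
    ∃ x : Space N, gdist x x₀ = r := by
  have h : x₀ + EuclideanSpace.single 0 1 ≠ x₀ := by simp
  exact ⟨_, gdist_polar (normSq_angle h) hr⟩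

theorem contDiffOn_inv_sinh_pow (k : ℕ) :
    ContDiffOn ℝ ∞ (fun r => (Real.sinh r ^ k)⁻¹) (Set.Ioi 0) :=
  (Real.contDiff_sinh.contDiffOn.pow k).inv
    fun _ hr => pow_ne_zero k (Real.sinh_pos_iff.2 hr).ne'

theorem integrable_radial (x₀ : Space N) {a b : ℝ} (ha : 0 < a) (hab : a ≤ b) {f : ℝ → ℝ}
    (hf : IsBump a b f) :
    Integrable (fun x => (Real.sinh (gdist x x₀) ^ (N - 1))⁻¹ * f (gdist x x₀)) (vol N) :=
  ((isTestFunction_radial x₀ ha hab hf).radial_mul (contDiffOn_inv_sinh_pow (N - 1))).integrable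

/-- If F is the compactly supported primitive of f, the integrand is the divergence of sinh^{-(N-1)}
r · F ∂/∂r. This replaces integration in polar coordinates. -/
theorem integral_radial_eq_zero [NeZero N] (x₀ : Space N) {a b : ℝ} (ha : 0 < a) (hab : a ≤ b)
    {f : ℝ → ℝ} (hf : IsBump a b f) (h0 : ∫ r, f r = 0) :
    ∫ x, (Real.sinh (gdist x x₀) ^ (N - 1))⁻¹ * f (gdist x x₀) ∂(vol N) = 0 := by
  obtain ⟨F, hF, hd⟩ := hf.exists_primitive h0
  have hp := (isTestFunction_radial x₀ ha hab hF).radial_mul (contDiffOn_inv_sinh_pow (N - 1))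
  rw [← integral_radial_divergence hp]
  refine integral_congr_off_pole x₀ fun x hx => ?_
  have hS := (sinh_gdist_pos hx).ne'
  have h1 := ((Real.hasDerivAt_sinh (gdist x x₀)).fun_pow (N - 1)).fun_inv
    (pow_ne_zero (N - 1) hS)
  rw [radialDeriv_radial hx fun r => (Real.sinh r ^ (N - 1))⁻¹ * F r, (h1.fun_mul (hd _)).deriv,
    coth]
  rcases (NeZero.one_le (n := N)).lt_or_eq with hN | rfl
  · obtain ⟨M, rfl⟩ : ∃ M, N = M + 2 := ⟨N - 2, by omega⟩
    simp only [show M + 2 - 1 = M + 1 by omega, Nat.add_sub_cancel]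
    push_cast
    field_simp
    ring
  · simp

theorem exists_bump {a b : ℝ} (hab : a < b) :
    ∃ f, IsBump a b f ∧ (∀ r, 0 ≤ f r) ∧ ∀ r ∈ Set.Ioo a b, 0 < f r := by
  let φ : ContDiffBump ((a + b) / 2) := ⟨(b - a) / 4, (b - a) / 2, by linarith, by linarith⟩
  have hφ : φ.rOut = (b - a) / 2 := rfl
  refine ⟨φ, ⟨φ.contDiff, fun r hr => ?_⟩, fun r => φ.nonneg, fun r hr => ?_⟩
  · refine φ.zero_of_le_dist ?_
    by_contra! h
    rw [Real.dist_eq, abs_lt, hφ] at h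
    exact hr ⟨by linarith [h.1], by linarith [h.2]⟩
  · refine φ.pos_of_mem_ball ?_
    rw [Real.ball_eq_Ioo, hφ]
    exact ⟨by linarith [hr.1], by linarith [hr.2]⟩

theorem IsBump.integral_pos {a b : ℝ} (hab : a < b) {f : ℝ → ℝ} (hf : IsBump a b f)
    (hpos : ∀ r ∈ Set.Ioo a b, 0 < f r) : 0 < ∫ r, f r := by
  rw [hf.integral_eq hab.le]
  exact intervalIntegral.intervalIntegral_pos_of_pos_on
    (hf.smooth.continuous.intervalIntegrable _ _) hpos hab

/-- A radial function whose integral against the radial density is positive has positive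
integral over hyperbolic space. -/
theorem integral_radial_pos [NeZero N] (x₀ : Space N) {a b : ℝ} (ha : 0 < a) (hab : a < b)
    {f : ℝ → ℝ} (hf : IsBump a b f) (h0 : 0 < ∫ r, f r) :
    0 < ∫ x, (Real.sinh (gdist x x₀) ^ (N - 1))⁻¹ * f (gdist x x₀) ∂(vol N) := by
  obtain ⟨χ, hχ, hχ0, hχpos⟩ := exists_bump hab
  have hI := hχ.integral_pos hab hχpos
  -- This c gives f - cχ integral zero on the line. Hence f and cχ have the same integral over
  -- hyperbolic space, where χ is nonnegative and not identically zero.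
  set c := (∫ r, f r) / ∫ r, χ r with hc
  have hc0 : 0 < c := div_pos h0 hI
  have hfχ := hf.add (hχ.const_mul (-c))
  have hz := integral_radial_eq_zero x₀ ha hab.le hfχ (by
    rw [integral_add hf.integrable (hχ.integrable.const_mul _), integral_const_mul, hc]
    field_simp
    ring)
  have hi := integrable_radial x₀ ha hab.le hf
  have hiχ := integrable_radial x₀ ha hab.le hχ
  have hsum : ∫ x, (Real.sinh (gdist x x₀) ^ (N - 1))⁻¹ * f (gdist x x₀) ∂(vol N) =
      c * ∫ x, (Real.sinh (gdist x x₀) ^ (N - 1))⁻¹ * χ (gdist x x₀) ∂(vol N) := by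
    have h1 := integral_sub hi (hiχ.const_mul c)
    rw [integral_const_mul] at h1
    rw [← sub_eq_zero, ← h1, ← hz]
    congr 1
    funext x
    ring
  rw [hsum]
  refine mul_pos hc0 ?_
  have hnn (x : Space N) : 0 ≤ (Real.sinh (gdist x x₀) ^ (N - 1))⁻¹ * χ (gdist x x₀) := by
    by_cases hx : x = x₀
    · have : gdist x₀ x₀ = 0 := by simp [gdist, minkowski_lift]
      rw [hx, this, hχ.zero 0 fun h => h.1.not_gt ha, mul_zero]
    · have := sinh_gdist_pos hx
      have := hχ0 (gdist x x₀)
      positivity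
  rw [integral_pos_iff_support_of_nonneg hnn hiχ]
  have hT := (isTestFunction_radial x₀ ha hab.le hχ).radial_mul (contDiffOn_inv_sinh_pow (N - 1))
  refine vol_pos_of_isOpen hT.1.continuous.isOpen_support ?_
  obtain ⟨x, hx⟩ := exists_gdist_eq x₀ (r := (a + b) / 2) (by linarith)
  refine ⟨x, ?_⟩
  have h1 := hχpos ((a + b) / 2) ⟨by linarith, by linarith⟩
  have h2 : 0 < Real.sinh ((a + b) / 2) := Real.sinh_pos_iff.2 (by linarith)
  rw [Function.mem_support, hx]
  positivity

/-! ### Radial profiles with small Rayleigh quotient. -/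

theorem sinh_le_two_mul {r : ℝ} (h0 : 0 ≤ r) (h1 : r ≤ 1) : Real.sinh r ≤ 2 * r := by
  have e1 := abs_le.1 (Real.abs_exp_sub_one_le (x := r) (by rwa [abs_of_nonneg h0]))
  have e2 := abs_le.1 (Real.abs_exp_sub_one_le (x := -r) (by rwa [abs_neg, abs_of_nonneg h0]))
  rw [abs_neg, abs_of_nonneg h0] at e2
  rw [abs_of_nonneg h0] at e1
  rw [Real.sinh_eq]
  linarith [e1.2, e2.1]

/-- The powers of r add up to -(N - 2) + (N - 1) = 1 in every dimension, so near the pole the weight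
is that of the plane, where the Hardy constant is zero. -/
theorem Psi_sq_mul_sinh_pow (hN : 1 ≤ N) (lam : ℝ) {r : ℝ} (hr : 0 < r) :
    Psi N lam r ^ 2 * Real.sinh r ^ (N - 1) = r * (Real.sinh r / r) ^ (-gam N lam) := by
  have hq : 0 < Real.sinh r / r := div_pos (Real.sinh_pos_iff.2 hr) hr
  have hS : Real.sinh r = r * (Real.sinh r / r) := by field_simp
  rw [show Real.sinh r ^ (N - 1) = r ^ (N - 1) * (Real.sinh r / r) ^ (N - 1) by
    rw [← mul_pow, ← hS], Psi]
  generalize Real.sinh r / r = q at *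
  rw [mul_pow, ← Real.rpow_natCast (n := 2), ← Real.rpow_natCast (n := 2),
    ← Real.rpow_natCast (n := N - 1), ← Real.rpow_natCast (n := N - 1), ← Real.rpow_mul hr.le,
    ← Real.rpow_mul hq.le, mul_mul_mul_comm, ← Real.rpow_add hr, ← Real.rpow_add hq,
    Nat.cast_sub hN]
  push_cast
  rw [show -(((N : ℝ) - 2) / 2) * 2 + ((N : ℝ) - 1) = 1 by ring, Real.rpow_one]
  congr 2
  ring

theorem Psi_sq_mul_sinh_pow_le (hN : 1 ≤ N) (lam : ℝ) {r : ℝ} (hr : 0 < r) :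
    Psi N lam r ^ 2 * Real.sinh r ^ (N - 1) ≤ r := by
  rw [Psi_sq_mul_sinh_pow hN lam hr]
  refine mul_le_of_le_one_right hr.le (Real.rpow_le_one_of_one_le_of_nonpos ?_ ?_)
  · rw [one_le_div hr]
    exact Real.self_le_sinh_iff.2 hr.le
  · exact neg_nonpos.2 (Real.sqrt_nonneg _)

theorem le_Psi_sq_mul_sinh_pow (hN : 1 ≤ N) (lam : ℝ) {r : ℝ} (hr : 0 < r) (hr1 : r ≤ 1) :
    2 ^ (-gam N lam) * r ≤ Psi N lam r ^ 2 * Real.sinh r ^ (N - 1) := by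
  rw [Psi_sq_mul_sinh_pow hN lam hr, mul_comm]
  refine mul_le_mul_of_nonneg_left (Real.rpow_le_rpow_of_nonpos
    (div_pos (Real.sinh_pos_iff.2 hr) hr) ?_ (neg_nonpos.2 (Real.sqrt_nonneg _))) hr.le
  rw [div_le_iff₀ hr]
  exact sinh_le_two_mul hr.le hr1

/-- The density `(sinh r)^{N-1} Ψ² (δ f² / sinh² r - f'²)`. -/
def defect (N : ℕ) (lam δ : ℝ) (f : ℝ → ℝ) (r : ℝ) : ℝ :=
  Real.sinh r ^ (N - 1) * (Psi N lam r ^ 2 * (δ / Real.sinh r ^ 2 * f r ^ 2 - deriv f r ^ 2))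

theorem IsBump.defect {a b : ℝ} {f : ℝ → ℝ} (hf : IsBump a b f) (ha : 0 < a) (N : ℕ)
    (lam δ : ℝ) : IsBump a b (defect N lam δ f) := by
  have hS : ContDiffOn ℝ ∞ (fun r => Real.sinh r ^ (N - 1)) (Set.Ioi 0) :=
    (Real.contDiff_sinh.pow _).contDiffOn
  have hP : ContDiffOn ℝ ∞ (fun r => Psi N lam r ^ 2) (Set.Ioi 0) := (contDiffOn_Psi N lam).pow 2
  have hd : ContDiffOn ℝ ∞ (fun r => δ / Real.sinh r ^ 2) (Set.Ioi 0) :=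
    contDiffOn_const.div (Real.contDiff_sinh.contDiffOn.pow 2)
      fun _ hr => pow_ne_zero 2 (Real.sinh_pos_iff.2 hr).ne'
  have h := (((hf.sq.radial_mul ha hd).add (hf.deriv.sq.const_mul (-1))).radial_mul ha
    hP).radial_mul ha hS
  convert h using 2 with r
  simp only [Hyperbolic.defect]
  ring

/-- Slowly varying functions of `log r` have small Rayleigh quotient near the pole. -/
theorem exists_bump_defect_pos (hN : 1 ≤ N) (lam : ℝ) {δ R : ℝ} (hδ : 0 < δ) (hR : 0 < R)
    (hR1 : R ≤ 1) :
    ∃ a b f, 0 < a ∧ a < b ∧ b < R ∧ IsBump a b f ∧ 0 < ∫ r, Psi N lam r * f r ∧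
      0 < ∫ r, defect N lam δ f r := by
  obtain ⟨φ, hφ, hφ0, hφpos⟩ := exists_bump (show (0 : ℝ) < 1 by norm_num)
  have hI : 0 < ∫ t in (0 : ℝ)..1, φ t ^ 2 := by
    rw [← hφ.sq.integral_eq zero_le_one]
    exact hφ.sq.integral_pos one_pos fun t ht => pow_pos (hφpos t ht) 2
  set m : ℝ := 2 ^ (-gam N lam) with hm
  have hm0 : 0 < m := Real.rpow_pos_of_pos two_pos _
  set A := ∫ t in (0 : ℝ)..1, φ t ^ 2
  set D := ∫ t in (0 : ℝ)..1, deriv φ t ^ 2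
  -- The stretching parameter. Positivity below needs D < n² δmA/4; as n ≥ 1, this linear bound
  -- suffices.
  obtain ⟨n, hn, hnD⟩ : ∃ n : ℝ, 1 ≤ n ∧ D < n * (δ * m / 4 * A) := by
    refine ⟨max 1 (D / (δ * m / 4 * A) + 1), le_max_left _ _, ?_⟩
    rw [← div_lt_iff₀ (by positivity)]
    exact (lt_add_one _).trans_le (le_max_right _ _)
  have hn0 : 0 < n := by linarith
  -- The interval has logarithmic length n, so τ maps it onto [0, 1], and it lies below R.
  set a := R * Real.exp (-(2 * n)) with ha
  set b := R * Real.exp (-n) with hb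
  have ha0 : 0 < a := by positivity
  have hb0 : 0 < b := by positivity
  have hab : a < b := by
    rw [ha, hb]
    gcongr
    linarith
  have hbR : b < R := mul_lt_of_lt_one_right hR (Real.exp_lt_one_iff.2 (by linarith))
  have hla : Real.log a = Real.log R - 2 * n := by
    rw [ha, Real.log_mul hR.ne' (Real.exp_ne_zero _), Real.log_exp]; ring
  have hlb : Real.log b = Real.log R - n := by
    rw [hb, Real.log_mul hR.ne' (Real.exp_ne_zero _), Real.log_exp]; ring
  set τ : ℝ → ℝ := fun r => (Real.log r - Real.log a) / n with hτ
  have hτd {r : ℝ} (hr : 0 < r) : HasDerivAt τ (1 / (n * r)) r := by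
    refine (((Real.hasDerivAt_log hr.ne').sub_const _).div_const n).congr_deriv ?_
    field_simp
  have hτa : τ a = 0 := by simp [hτ]
  have hτb : τ b = 1 := by
    simp only [hτ, hla, hlb]
    field_simp
    ring
  have hf : IsBump a b ((Set.Ioi 0).indicator (φ ∘ τ)) := by
    refine IsBump.indicator ha0 (hφ.smooth.comp_contDiffOn ?_) fun r hr hrab => ?_
    · exact ((contDiffOn_id.log fun r hr => (Set.mem_Ioi.1 hr).ne').sub contDiffOn_const).div_const n
    · refine hφ.zero _ fun h => hrab ?_
      rw [← hτa, ← hτb] at h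
      simp only [hτ] at h
      constructor
      · have := (div_le_div_iff_of_pos_right hn0).1 h.1
        exact (Real.log_le_log_iff ha0 hr).1 (by linarith)
      · have := (div_le_div_iff_of_pos_right hn0).1 h.2
        exact (Real.log_le_log_iff hr hb0).1 (by linarith)
  set f := (Set.Ioi 0).indicator (φ ∘ τ) with hfdef
  have hfr {r : ℝ} (hr : 0 < r) : f r = φ (τ r) := Set.indicator_of_mem (Set.mem_Ioi.2 hr) _
  have hfd {r : ℝ} (hr : 0 < r) : deriv f r = deriv φ (τ r) * (1 / (n * r)) := by
    have h1 : f =ᶠ[𝓝 r] fun s => φ (τ s) := by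
      filter_upwards [Ioi_mem_nhds hr] with s hs using hfr hs
    rw [h1.deriv_eq]
    exact ((hφ.smooth.differentiable (by simp) (τ r)).hasDerivAt.comp r (hτd hr)).deriv
  refine ⟨a, b, f, ha0, hab, hbR, hf, ?_, ?_⟩
  · refine (hf.radial_mul ha0 (contDiffOn_Psi N lam)).integral_pos hab fun r hr => ?_
    have hr0 : 0 < r := ha0.trans hr.1
    rw [hfr hr0]
    refine mul_pos (Psi_pos N lam hr0) (hφpos _ ⟨?_, ?_⟩)
    · rw [← hτa]
      simp only [hτ]
      gcongr
      exact hr.1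
    · rw [← hτb]
      simp only [hτ]
      gcongr
      exact hr.2
  · rw [(hf.defect ha0 N lam δ).integral_eq hab.le]
    -- Lower bound for the defect in the variable t = τ(r), where dt = dr / (n r). The weight lies
    -- between m r and r, and sinh r ≤ 2r accounts for the 4.
    set k : ℝ → ℝ := fun t => δ * m / 4 * n * φ t ^ 2 - 1 / n * deriv φ t ^ 2 with hk
    have hφc := hφ.smooth.continuous
    have hφc' := hφ.deriv.smooth.continuous
    have hkc : Continuous k := by fun_prop
    have hks : ∫ t in (0 : ℝ)..1, k t = δ * m / 4 * n * A - 1 / n * D := by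
      rw [hk, intervalIntegral.integral_sub, intervalIntegral.integral_const_mul,
        intervalIntegral.integral_const_mul] <;>
      exact Continuous.intervalIntegrable (by fun_prop) _ _
    have hkpos : 0 < ∫ t in (0 : ℝ)..1, k t := by
      rw [hks, sub_pos, one_div, inv_mul_lt_iff₀ hn0]
      have h1 : 0 ≤ n * (δ * m / 4 * A) := by positivity
      linarith [mul_le_mul_of_nonneg_left hn h1]
    have hsub : ∀ r ∈ Set.uIcc a b, 0 < r := fun r hr => by
      rw [Set.uIcc_of_le hab.le] at hr
      exact ha0.trans_le hr.1
    have hcd : ContinuousOn (fun r : ℝ => 1 / (n * r)) (Set.uIcc a b) :=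
      continuousOn_const.div (by fun_prop) fun r hr => (mul_pos hn0 (hsub r hr)).ne'
    have hτc : ContinuousOn τ (Set.uIcc a b) := fun r hr =>
      (hτd (hsub r hr)).continuousAt.continuousWithinAt
    have hcv := intervalIntegral.integral_comp_mul_deriv' (g := k) (fun r hr => hτd (hsub r hr))
      hcd hkc.continuousOn
    rw [hτa, hτb] at hcv
    rw [← hcv] at hkpos
    refine hkpos.trans_le (intervalIntegral.integral_mono_on hab.le ?_
      ((hf.defect ha0 N lam δ).smooth.continuous.intervalIntegrable _ _) fun r hr => ?_)
    · exact ((hkc.comp_continuousOn hτc).mul hcd).intervalIntegrable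
    · have hr0 : 0 < r := ha0.trans_le hr.1
      have hr1 : r ≤ 1 := hr.2.trans (hbR.le.trans hR1)
      have hS0 := Real.sinh_pos_iff.2 hr0
      have hS := sinh_le_two_mul hr0.le hr1
      have hG1 := le_Psi_sq_mul_sinh_pow hN lam hr0 hr1
      have hG2 := Psi_sq_mul_sinh_pow_le hN lam hr0
      have e : defect N lam δ f r =
          (Psi N lam r ^ 2 * Real.sinh r ^ (N - 1)) * (δ / Real.sinh r ^ 2) * φ (τ r) ^ 2 -
          (Psi N lam r ^ 2 * Real.sinh r ^ (N - 1)) * (deriv φ (τ r) * (1 / (n * r))) ^ 2 := by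
        rw [defect, hfr hr0, hfd hr0]
        ring
      have e1 : (m * r) * (δ / (2 * r) ^ 2) * φ (τ r) ^ 2 ≤
          (Psi N lam r ^ 2 * Real.sinh r ^ (N - 1)) * (δ / Real.sinh r ^ 2) * φ (τ r) ^ 2 := by
        gcongr
      have e2 : (Psi N lam r ^ 2 * Real.sinh r ^ (N - 1)) * (deriv φ (τ r) * (1 / (n * r))) ^ 2 ≤
          r * (deriv φ (τ r) * (1 / (n * r))) ^ 2 := by
        gcongr
      have e3 : k (τ r) * (1 / (n * r)) = (m * r) * (δ / (2 * r) ^ 2) * φ (τ r) ^ 2 -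
          r * (deriv φ (τ r) * (1 / (n * r))) ^ 2 := by
        simp only [hk]
        field_simp
        ring
      simp only [Function.comp_apply]
      rw [e, e3]
      linarith

/-- A radial profile `f` with `∫ Ψ f = 0`, so that `Ψ f` is the radial derivative of a test
function, and with small Rayleigh quotient. -/
theorem exists_bump_integral_zero_defect_pos (hN : 1 ≤ N) (lam : ℝ) {δ : ℝ} (hδ : 0 < δ) :
    ∃ a b f, 0 < a ∧ a < b ∧ IsBump a b f ∧ ∫ r, Psi N lam r * f r = 0 ∧
      0 < ∫ r, defect N lam δ f r := by
  obtain ⟨a₁, b₁, f₁, ha₁, hab₁, hb₁, hf₁, hP₁, hD₁⟩ :=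
    exists_bump_defect_pos hN lam hδ one_pos le_rfl
  obtain ⟨a₂, b₂, f₂, ha₂, hab₂, hb₂, hf₂, hP₂, hD₂⟩ :=
    -- Taking R = a₁ puts the second support strictly below the first. The cross terms of the
    -- quadratic defect then vanish, so c may be any real number and is free to cancel ∫ Ψ f.
    exists_bump_defect_pos hN lam hδ ha₁ (hab₁.le.trans hb₁.le)
  set c := -((∫ r, Psi N lam r * f₁ r) / ∫ r, Psi N lam r * f₂ r) with hc
  have g₁ := hf₁.mono (hab₂.trans hb₂).le le_rfl
  have g₂ := hf₂.mono le_rfl (hb₂.trans hab₁).le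
  refine ⟨a₂, b₁, fun r => f₁ r + c * f₂ r, ha₂, (hab₂.trans hb₂).trans hab₁,
    g₁.add (g₂.const_mul c), ?_, ?_⟩
  · have i₁ := (hf₁.radial_mul ha₁ (contDiffOn_Psi N lam)).integrable
    have i₂ := (hf₂.radial_mul ha₂ (contDiffOn_Psi N lam)).integrable
    have h := integral_add i₁ (i₂.const_mul c)
    rw [integral_const_mul] at h
    rw [show (fun r => Psi N lam r * (f₁ r + c * f₂ r)) =
      fun r => Psi N lam r * f₁ r + c * (Psi N lam r * f₂ r) by funext r; ring, h, hc]
    field_simp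
    ring
  · have i₁ := (hf₁.defect ha₁ N lam δ).integrable
    have i₂ := (hf₂.defect ha₂ N lam δ).integrable
    have h := integral_add i₁ (i₂.const_mul (c ^ 2))
    rw [integral_const_mul] at h
    have e : defect N lam δ (fun r => f₁ r + c * f₂ r) =
        fun r => defect N lam δ f₁ r + c ^ 2 * defect N lam δ f₂ r := by
      funext r
      have hd : deriv (fun r => f₁ r + c * f₂ r) r = deriv f₁ r + c * deriv f₂ r :=
        ((hf₁.smooth.differentiable (by simp) r).hasDerivAt.add
          ((hf₂.smooth.differentiable (by simp) r).hasDerivAt.const_mul c)).deriv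
      have h0 : f₁ r * f₂ r = 0 ∧ deriv f₁ r * deriv f₂ r = 0 := by
        by_cases hr : r ∈ Set.Icc a₁ b₁
        · have hr2 : r ∉ Set.Icc a₂ b₂ := fun h => by linarith [h.2, hr.1]
          simp [hf₂.zero r hr2, hf₂.deriv.zero r hr2]
        · simp [hf₁.zero r hr, hf₁.deriv.zero r hr]
      simp only [defect, hd]
      linear_combination Real.sinh r ^ (N - 1) * Psi N lam r ^ 2 *
        (2 * c * (δ / Real.sinh r ^ 2) * h0.1 - 2 * c * h0.2)
    rw [e, h]
    positivity

/-! ### Sharpness of the constants. -/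

theorem radialDeriv_congr {x₀ x : Space N} (h : x ≠ x₀) {u v : Space N → ℝ}
    (huv : ∀ y, y ≠ x₀ → u y = v y) : radialDeriv x₀ u x = radialDeriv x₀ v x := by
  have h1 := (hasDerivAt_polar_angle h).continuousAt
  have h2 : ∀ᶠ s in 𝓝 (gdist x x₀), polar x₀ s (angle x₀ x) ∈ {y | y ≠ x₀} :=
    h1.eventually_mem (isOpen_ne.mem_nhds (by rwa [polar_angle h]))
  exact EventuallyEq.deriv_eq (h2.mono fun s hs => huv _ hs)

/-- The function is radial with u_r = Ψ f, so u_r / Ψ = f and the difference of the two sides is the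
hyperbolic integral of the defect of f divided by sinh^{N-1} r. -/
theorem exists_isTestFunction_remainder_lt [NeZero N] (x₀ : Space N) (lam : ℝ) {δ : ℝ}
    (hδ : 0 < δ) :
    ∃ u : Space N → ℝ, IsTestFunction x₀ u ∧
      ∫ x, Psi N lam (gdist x x₀) ^ 2 * normSq x (radialGrad x₀
          (fun y => radialDeriv x₀ u y / Psi N lam (gdist y x₀)) x) ∂(vol N) <
        δ * ∫ x, normSq x (radialGrad x₀ u x) / Real.sinh (gdist x x₀) ^ 2 ∂(vol N) := by
  obtain ⟨a, b, f, ha, hab, hf, hP, hD⟩ :=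
    exists_bump_integral_zero_defect_pos (NeZero.one_le (n := N)) lam hδ
  have hv := hf.radial_mul ha (contDiffOn_Psi N lam)
  obtain ⟨U, hU, hUd⟩ := hv.exists_primitive hP
  refine ⟨fun x => U (gdist x x₀), isTestFunction_radial x₀ ha hab.le hU, ?_⟩
  have hu (x : Space N) (hx : x ≠ x₀) : radialDeriv x₀ (fun x => U (gdist x x₀)) x =
      Psi N lam (gdist x x₀) * f (gdist x x₀) := by
    rw [radialDeriv_radial hx U, (hUd _).deriv]
  have hP2 : ContDiffOn ℝ ∞ (fun r => Psi N lam r ^ 2) (Set.Ioi 0) := (contDiffOn_Psi N lam).pow 2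
  have hS2 : ContDiffOn ℝ ∞ (fun r => 1 / Real.sinh r ^ 2) (Set.Ioi 0) :=
    contDiffOn_const.div (Real.contDiff_sinh.contDiffOn.pow 2)
      fun _ hr => pow_ne_zero 2 (Real.sinh_pos_iff.2 hr).ne'
  have i1 := (isTestFunction_radial x₀ ha hab.le (hv.sq.radial_mul ha hS2)).integrable
  have i2 := (isTestFunction_radial x₀ ha hab.le (hf.deriv.sq.radial_mul ha hP2)).integrable
  have e1 : ∫ x, normSq x (radialGrad x₀ (fun x => U (gdist x x₀)) x) /
        Real.sinh (gdist x x₀) ^ 2 ∂(vol N) =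
      ∫ x, 1 / Real.sinh (gdist x x₀) ^ 2 * (Psi N lam (gdist x x₀) * f (gdist x x₀)) ^ 2
        ∂(vol N) :=
    integral_congr_off_pole x₀ fun x hx => by
      rw [normSq_radialGrad hx, hu x hx]
      ring
  have e2 : ∫ x, Psi N lam (gdist x x₀) ^ 2 * normSq x (radialGrad x₀ (fun y =>
        radialDeriv x₀ (fun x => U (gdist x x₀)) y / Psi N lam (gdist y x₀)) x) ∂(vol N) =
      ∫ x, Psi N lam (gdist x x₀) ^ 2 * deriv f (gdist x x₀) ^ 2 ∂(vol N) :=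
    integral_congr_off_pole x₀ fun x hx => by
      rw [normSq_radialGrad hx, radialDeriv_congr hx (v := fun y => f (gdist y x₀)),
        radialDeriv_radial hx f]
      intro y hy
      rw [hu y hy, mul_div_cancel_left₀ _ (Psi_pos N lam (gdist_pos hy)).ne']
  rw [e1, e2, ← sub_pos, ← integral_const_mul, ← integral_sub (i1.const_mul δ) i2]
  have hpos := integral_radial_pos x₀ ha hab (hf.defect ha N lam δ) hD
  refine hpos.trans_eq (integral_congr_off_pole x₀ fun x hx => ?_)
  have hS := (sinh_gdist_pos hx).ne'
  simp only [defect]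
  field_simp

end Hyperbolic

end

open Hyperbolic in
theorem theorem2p1 (N : ℕ) (hN2 : 2 ≤ N) (x₀ : Hyperbolic.Space N) (lam : ℝ)
    (hlam₀ : 0 ≤ lam) (hlam₁ : lam ≤ (((N : ℝ) - 1) / 2) ^ 2) :
    (∀ u : Hyperbolic.Space N → ℝ, IsTestFunction x₀ u →
      ∫ x, |radialLaplacian x₀ u x| ^ 2 ∂(vol N) =
        lam * ∫ x, normSq x (radialGrad x₀ u x) ∂(vol N)
        + hN N lam ^ 2 * ∫ x, normSq x (radialGrad x₀ u x) / gdist x x₀ ^ 2 ∂(vol N)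
        + (((N : ℝ) / 2) ^ 2 - hN N lam ^ 2) *
            ∫ x, normSq x (radialGrad x₀ u x) / Real.sinh (gdist x x₀) ^ 2 ∂(vol N)
        + gam N lam * hN N lam *
            ∫ x, (gdist x x₀ * coth (gdist x x₀) - 1) / gdist x x₀ ^ 2
              * normSq x (radialGrad x₀ u x) ∂(vol N)
        + ∫ x, Psi N lam (gdist x x₀) ^ 2
              * normSq x (radialGrad x₀
                  (fun y => radialDeriv x₀ u y / Psi N lam (gdist y x₀)) x) ∂(vol N)) ∧
    (5 ≤ N → ∀ C : ℝ, ((N : ℝ) / 2) ^ 2 - hN N lam ^ 2 < C →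
      ¬ ∀ u : Hyperbolic.Space N → ℝ, IsTestFunction x₀ u →
        ∫ x, |radialLaplacian x₀ u x| ^ 2 ∂(vol N) ≥
          lam * ∫ x, normSq x (radialGrad x₀ u x) ∂(vol N)
          + hN N lam ^ 2 * ∫ x, normSq x (radialGrad x₀ u x) / gdist x x₀ ^ 2 ∂(vol N)
          + C * ∫ x, normSq x (radialGrad x₀ u x) / Real.sinh (gdist x x₀) ^ 2 ∂(vol N)
          + gam N lam * hN N lam *
              ∫ x, (gdist x x₀ * coth (gdist x x₀) - 1) / gdist x x₀ ^ 2
                * normSq x (radialGrad x₀ u x) ∂(vol N)) := by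
  have : NeZero N := ⟨by omega⟩
  refine ⟨fun u hu => integral_radialLaplacian_sq hlam₁ hu, fun _ C hC h => ?_⟩
  -- Here δ = C - ((N/2)² - h²). Subtracting the identity from the supposed inequality would bound
  -- the remainder below by δ ∫ |u_r|² / sinh² r.
  obtain ⟨u, hu, hlt⟩ := exists_isTestFunction_remainder_lt x₀ lam (sub_pos.2 hC)
  have h1 := h u hu
  rw [integral_radialLaplacian_sq hlam₁ hu] at h1
  linarith
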